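/- Let $\tau,\mu\in\mathbb C$ with $\operatorname{Im}\tau>0$, let $\Lambda=\mathbb Z+\tau\mathbb Z$ and suppose $\mu\notin\Lambda$. Put $$\vartheta_1(z,\tau)=-\sum_{n\in\mathbb Z+\frac12}e^{i\pi n^2\tau+2\pi i n(z+\frac12)},\qquad \sigma_w(z,\tau)=\frac{\vartheta_1(z-w,\tau)\,\vartheta_1'(0,\tau)}{\vartheta_1(z,\tau)\,\vartheta_1(-w,\tau)},$$ where the prime is the derivative in the first argument. For a function $f$ of two complex variables and $\xi\in\mathbb C$ let $$R(\xi)f(z_1,z_2)=\sigma_\mu(z_1-z_2,\tau)f(z_1,z_2)-\sigma_\xi(z_1-z_2,\tau)f(z_2,z_1),$$ where at points with $z_1-z_2\in\Lambda$ the right-hand side is understood as its limit in $z_1$, if this exists (removable singularities are removed). Let $k$ be a positive integer, let $T_k(\xi)f(z)=f(z-\xi/k)$, and for $\xi_1,\xi_2\in\mathbb C$ consider the operator $$\bigl(T_k(\xi_1+\mu)^{-1}\otimes T_k(\xi_2)^{-1}\bigr)\,R(\xi_1-\xi_2)\,\bigl(T_k(\xi_1)\otimes T_k(\xi_2+\mu)\bigr).$$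 Let $V_k$ be the space of entire functions $f$ of one variable with $f(z+1)=f(z)$ and $f(z+\tau)=e^{-2\pi i k z-\pi i k\tau}f(z)$, and identify $V_k^{\otimes n}$ with the space of entire functions of $z_1,\dots,z_n$ that belong to $V_k$ as functions of each $z_i$, for any fixed values of the other arguments. Then: (1) The operator above depends on $\xi_1,\xi_2$ only through $\xi_1-\xi_2$; denote it by $R_k(\xi_1-\xi_2)$. (2) For every $\xi\in\mathbb C\setminus\Lambda$, the operator $R_k(\xi)$ maps $V_k\otimes V_k$ linearly into itself. (3) Let $\xi_1,\xi_2,\xi_3\in\mathbb C$ with $\xi_{ij}=\xi_i-\xi_j\notin\Lambda$ for $i<j$, and let $R_k^{(ij)}$ denote $R_k$ acting on a function of three variables viewed as a function of its $i$-th and $j$-th variables. Then the quantum Yang--Baxter equation $$R_k^{(12)}(\xi_{12})R_k^{(13)}(\xi_{13})R_k^{(23)}(\xi_{23})f=R_k^{(23)}(\xi_{23})R_k^{(13)}(\xi_{13})R_k^{(12)}(\xi_{12})f$$ holds for all $f\in V_k\otimes V_k\otimes V_k$. For an arbitrary function $f:\mathbb C^3\to\mathbb C$ it holds at every point $(z_1,z_2,z_3)$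 for which none of $z_1-z_2+\frac{\xi_{12}+\mu}{k}$, $z_1-z_3+\frac{\xi_{13}+2\mu}{k}$, $z_2-z_3+\frac{\xi_{23}+\mu}{k}$ lies in $\Lambda$. -/

import Mathlib

open Topology

noncomputable section

namespace EllipticR

/-- Jacobi's theta function
`ϑ₁(z, τ) = - ∑_{n ∈ ℤ + 1/2} exp (i π n² τ + 2 π i n (z + 1/2))`. -/
def theta1 (z τ : ℂ) : ℂ :=
  -∑' m : ℤ, Complex.exp
    (Complex.I * Real.pi * ((m : ℂ) + 1 / 2) ^ 2 * τ
      + 2 * Real.pi * Complex.I * ((m : ℂ) + 1 / 2) * (z + 1 / 2))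

/-- The period lattice `ℤ + τ ℤ`. -/
def lattice (τ : ℂ) : Set ℂ := {w | ∃ m n : ℤ, w = m + n * τ}

/-- The function `σ_w(z, τ) = ϑ₁(z - w, τ) ϑ₁'(0, τ) / (ϑ₁(z, τ) ϑ₁(-w, τ))`. It is meaningful for
`w ∉ ℤ + τ ℤ` and then has its poles at `z ∈ ℤ + τ ℤ`. -/
def sigma (w z τ : ℂ) : ℂ :=
  theta1 (z - w) τ * deriv (fun x => theta1 x τ) 0 / (theta1 z τ * theta1 (-w) τ)

/-- Functions of `n` complex variables. -/
abbrev Fun (n : ℕ) : Type := (Fin n → ℂ) → ℂ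

/-- An operator on functions of one variable, acting on the `i`-th variable of a function of
`n` variables. -/
def onVar {n : ℕ} (i : Fin n) (A : (ℂ → ℂ) → (ℂ → ℂ)) (f : Fun n) : Fun n :=
  fun z => A (fun x => f (Function.update z i x)) (z i)

/-- An operator on functions of two variables, acting on the `i`-th and `j`-th variables
(`i ≠ j`) of a function of `n` variables. -/
def onPair {n : ℕ} (i j : Fin n) (B : Fun 2 → Fun 2) (f : Fun n) : Fun n :=
  fun z => B (fun w => f (Function.update (Function.update z i (w 0)) j (w 1))) ![z i, z j]

/-- `A ⊗ B` acting on functions of two variables. -/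
def tensorOp (A B : (ℂ → ℂ) → (ℂ → ℂ)) (f : Fun 2) : Fun 2 :=
  onVar 0 A (onVar 1 B f)

/-- The expression `σ_μ(z₁ - z₂, τ) f(z₁, z₂) - σ_ξ(z₁ - z₂, τ) f(z₂, z₁)`. -/
def rExpr (τ μ ξ : ℂ) (f : Fun 2) (z₁ z₂ : ℂ) : ℂ :=
  sigma μ (z₁ - z₂) τ * f ![z₁, z₂] - sigma ξ (z₁ - z₂) τ * f ![z₂, z₁]

open Classical in
/-- The Shibukawa-Ueno operator
`R(ξ) f (z₁, z₂) = σ_μ(z₁ - z₂, τ) f(z₁, z₂) - σ_ξ(z₁ - z₂, τ) f(z₂, z₁)`.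
At the apparent singularities `z₁ - z₂ ∈ ℤ + τ ℤ` of this expression the value is its limit (in the
first variable), that is, removable singularities are removed. -/
def rOp (τ μ ξ : ℂ) (f : Fun 2) : Fun 2 := fun z =>
  if z 0 - z 1 ∈ lattice τ then
    Filter.limUnder (𝓝[≠] (z 0)) (fun x => rExpr τ μ ξ f x (z 1))
  else rExpr τ μ ξ f (z 0) (z 1)

/-- The translation operator `T_k(ξ) f (z) = f (z - ξ / k)`. -/
def transl (k ξ : ℂ) : (ℂ → ℂ) ≃ₗ[ℂ] (ℂ → ℂ) where
  toFun f z := f (z - ξ / k)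
  invFun f z := f (z + ξ / k)
  map_add' _ _ := rfl
  map_smul' _ _ := rfl
  left_inv f := by funext z; simp
  right_inv f := by funext z; simp

/-- The conjugated operator
`(T_k(ξ₁ + μ)⁻¹ ⊗ T_k(ξ₂)⁻¹) R(ξ₁ - ξ₂) (T_k(ξ₁) ⊗ T_k(ξ₂ + μ))`. -/
def conjR (τ μ k ξ₁ ξ₂ : ℂ) (f : Fun 2) : Fun 2 :=
  tensorOp (transl k (ξ₁ + μ)).symm (transl k ξ₂).symm
    (rOp τ μ (ξ₁ - ξ₂)
      (tensorOp (transl k ξ₁) (transl k (ξ₂ + μ)) f))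

/-- The operator `R_k(ξ)`: the conjugated operator at spectral parameters `ξ₁ = ξ`, `ξ₂ = 0`, hence
with difference `ξ₁ - ξ₂ = ξ`. -/
def Rk (τ μ k ξ : ℂ) : Fun 2 → Fun 2 := conjR τ μ k ξ 0

/-- The multiplier `α_k(z, ξ) = exp (-2 π i k z - π i k τ + 2 π i ξ)`. -/
def alpha (τ : ℂ) (k : ℕ) (z ξ : ℂ) : ℂ :=
  Complex.exp (-2 * Real.pi * Complex.I * k * z - Real.pi * Complex.I * k * τ
    + 2 * Real.pi * Complex.I * ξ)

/-- The space `V_k(ξ)` of shifted theta functions of degree `k`: entire functions `f` with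
`f (z + 1) = f z` and `f (z + τ) = α_k(z, ξ) f z`. -/
def V (τ : ℂ) (k : ℕ) (ξ : ℂ) : Submodule ℂ (ℂ → ℂ) where
  carrier := {f | Differentiable ℂ f ∧ (∀ z, f (z + 1) = f z) ∧
    ∀ z, f (z + τ) = alpha τ k z ξ * f z}
  add_mem' := by
    rintro f g ⟨hf, hf1, hf2⟩ ⟨hg, hg1, hg2⟩
    refine ⟨hf.add hg, fun z => ?_, fun z => ?_⟩
    · simp [hf1 z, hg1 z]
    · simp [hf2 z, hg2 z, mul_add]
  zero_mem' := ⟨differentiable_const 0, fun _ => rfl, fun _ => by simp⟩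
  smul_mem' := by
    rintro c f ⟨hf, hf1, hf2⟩
    refine ⟨hf.const_smul c, fun z => ?_, fun z => ?_⟩
    · simp [hf1 z]
    · simp [hf2 z, mul_left_comm]

/-- The tensor product `V_k(ξ₁) ⊗ ⋯ ⊗ V_k(ξₙ)`, realised as the space of entire functions of
`z₁, …, zₙ` that belong to `V_k(ξᵢ)` as functions of `zᵢ`, for any fixed value of the other
arguments. -/
def tensorV (τ : ℂ) (k : ℕ) {n : ℕ} (ξ : Fin n → ℂ) : Submodule ℂ (Fun n) where
  carrier := {f | Differentiable ℂ f ∧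
    ∀ (i : Fin n) (z : Fin n → ℂ), (fun x => f (Function.update z i x)) ∈ V τ k (ξ i)}
  add_mem' := by
    rintro f g ⟨hf, hf1⟩ ⟨hg, hg1⟩
    exact ⟨hf.add hg, fun i z => (V τ k (ξ i)).add_mem (hf1 i z) (hg1 i z)⟩
  zero_mem' := ⟨differentiable_const 0, fun i _ => (V τ k (ξ i)).zero_mem⟩
  smul_mem' := by
    rintro c f ⟨hf, hf1⟩
    exact ⟨hf.const_smul c, fun i z => (V τ k (ξ i)).smul_mem c (hf1 i z)⟩

end EllipticR

end

noncomputable section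

namespace EllipticR

open Complex Filter

/-! ### Quasi-periodicity of the theta function -/

/-! Written out, `Rk` multiplies two translates of `f`, one with its arguments exchanged, by `sigma
μ` and `sigma ξ` at the common argument D = zᵢ - zⱼ + (ξ + μ)/k. Only the difference of the spectral
parameters enters, which is (1) (`conjR_eq_Rk`).

For (2), both coefficients have residue 1 at D = 0, and there the two translated points coincide, so
the poles cancel (`rkNum_eq_zero`). Quasi-periodicity carries the cancellation to the whole lattice.
Since ϑ₁ has simple zeros, exactly on the lattice, the numerator is divisible by ϑ₁(D) among entire
functions (`exists_differentiable_mul_eq`). The quotient keeps the multipliers of `f`, because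
translations by multiples of 1/k compensate the multiplier of ϑ₁. The zeros of ϑ₁ come from
comparison with an infinite product having the same quasi-periods: the quotient is entire and doubly
periodic, hence constant. If ϑ₁'(0) were 0, all coefficients and operators would vanish, so this
case needs no exclusion.

For (3), both sides expand into eight terms. Matching values of `f` leaves two instances of Fay's
identity (`sigma_mul_sigma`) and one relation between triple products (`sigma_four_term`). All
follow from the Weierstrass three-term identity, which is a Plücker relation once ϑ₁(x+y)ϑ₁(x-y) is
written as a 2×2 determinant. On theta functions both sides are entire, so equality away from the
poles suffices. -/

lemma theta1_eq (z τ : ℂ) :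
    theta1 z τ = -(exp (Real.pi * I * τ / 4 + Real.pi * I * (z + 1 / 2))
      * jacobiTheta₂ (z + 1 / 2 + τ / 2) τ) := by
  rw [theta1, jacobiTheta₂, ← tsum_mul_left]
  congr 1
  refine tsum_congr fun m => ?_
  rw [jacobiTheta₂_term, ← exp_add]
  congr 1
  ring

lemma differentiable_theta1 {τ : ℂ} (hτ : 0 < τ.im) : Differentiable ℂ (fun z => theta1 z τ) := by
  intro z
  simp only [theta1_eq]
  have h : DifferentiableAt ℂ (fun z : ℂ => jacobiTheta₂ (z + 1 / 2 + τ / 2) τ) z :=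
    DifferentiableAt.comp (f := fun z : ℂ => z + 1 / 2 + τ / 2) (g := fun z => jacobiTheta₂ z τ) z
      (differentiableAt_jacobiTheta₂_fst _ hτ) (by fun_prop)
  exact ((by fun_prop : DifferentiableAt ℂ
    (fun z : ℂ => exp (Real.pi * I * τ / 4 + Real.pi * I * (z + 1 / 2))) z).mul h).neg

lemma theta1_add_one (z τ : ℂ) : theta1 (z + 1) τ = -theta1 z τ := by
  rw [theta1_eq, theta1_eq, show z + 1 + 1 / 2 + τ / 2 = (z + 1 / 2 + τ / 2) + 1 by ring,
    jacobiTheta₂_add_left, show (Real.pi * I * τ / 4 + Real.pi * I * (z + 1 + 1 / 2) : ℂ)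
      = Real.pi * I * τ / 4 + Real.pi * I * (z + 1 / 2) + Real.pi * I by ring, exp_add _ (Real.pi * I),
    exp_pi_mul_I]
  ring

lemma theta1_add_tau (z τ : ℂ) :
    theta1 (z + τ) τ = -exp (-(Real.pi * I * τ) - 2 * Real.pi * I * z) * theta1 z τ := by
  rw [theta1_eq, theta1_eq, show z + τ + 1 / 2 + τ / 2 = (z + 1 / 2 + τ / 2) + τ by ring,
    jacobiTheta₂_add_left']
  have : exp (Real.pi * I * τ / 4 + Real.pi * I * (z + τ + 1 / 2))
      * exp (-Real.pi * I * (τ + 2 * (z + 1 / 2 + τ / 2)))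
      = -(exp (-(Real.pi * I * τ) - 2 * Real.pi * I * z)
        * exp (Real.pi * I * τ / 4 + Real.pi * I * (z + 1 / 2))) := by
    rw [← exp_add, ← exp_add, ← neg_one_mul (exp _), ← exp_neg_pi_mul_I, ← exp_add]
    congr 1
    ring
  linear_combination (-jacobiTheta₂ (z + 1 / 2 + τ / 2) τ) * this

lemma theta1_neg (z τ : ℂ) : theta1 (-z) τ = -theta1 z τ := by
  rw [theta1_eq, theta1_eq, ← jacobiTheta₂_neg_left,
    show z + 1 / 2 + τ / 2 = -(-z + 1 / 2 + τ / 2) + 1 + τ by ring, jacobiTheta₂_add_left',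
    jacobiTheta₂_add_left]
  have : exp (Real.pi * I * τ / 4 + Real.pi * I * (-z + 1 / 2))
      = -(exp (Real.pi * I * τ / 4 + Real.pi * I * (z + 1 / 2))
      * exp (-Real.pi * I * (τ + 2 * (-(-z + 1 / 2 + τ / 2) + 1)))) := by
    rw [← exp_add, ← neg_one_mul (exp _), ← exp_pi_mul_I, ← exp_add, exp_eq_exp_iff_exists_int]
    refine ⟨0, ?_⟩
    push_cast
    ring
  linear_combination (-jacobiTheta₂ (-(-z + 1 / 2 + τ / 2)) τ) * this

lemma theta1_zero (τ : ℂ) : theta1 0 τ = 0 := by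
  have := theta1_neg 0 τ
  rw [neg_zero] at this
  linear_combination this / 2

/-! ### The lattice -/

lemma add_mem_lattice {τ v w : ℂ} (hv : v ∈ lattice τ) (hw : w ∈ lattice τ) :
    v + w ∈ lattice τ := by
  obtain ⟨m, n, rfl⟩ := hv
  obtain ⟨m', n', rfl⟩ := hw
  exact ⟨m + m', n + n', by push_cast; ring⟩

lemma neg_mem_lattice {τ v : ℂ} (hv : v ∈ lattice τ) : -v ∈ lattice τ := by
  obtain ⟨m, n, rfl⟩ := hv
  exact ⟨-m, -n, by push_cast; ring⟩

lemma neg_mem_lattice_iff {τ v : ℂ} : -v ∈ lattice τ ↔ v ∈ lattice τ :=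
  ⟨fun h => neg_neg v ▸ neg_mem_lattice h, neg_mem_lattice⟩

lemma tau_mem_lattice (τ : ℂ) : τ ∈ lattice τ := ⟨0, 1, by simp⟩

/-- A property of points of the lattice holds if it is stable under the two generating
translations, in both directions. -/
lemma lattice_induction {τ : ℂ} {p : ℂ → Prop} (h0 : p 0) (h1 : ∀ z, p (z + 1) ↔ p z)
    (h2 : ∀ z, p (z + τ) ↔ p z) {w : ℂ} (hw : w ∈ lattice τ) : p w := by
  obtain ⟨m, n, rfl⟩ := hw
  have hm : p (m : ℂ) := by
    induction m using Int.induction_on with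
    | zero => simpa using h0
    | succ i hi => push_cast at hi ⊢; exact (h1 _).2 hi
    | pred i hi =>
      refine (h1 _).1 ?_
      push_cast at hi ⊢
      simpa using hi
  induction n using Int.induction_on with
  | zero => simpa using hm
  | succ i hi =>
    have := (h2 _).2 hi
    push_cast at this ⊢
    rwa [show (m : ℂ) + (i + 1) * τ = m + i * τ + τ by ring]
  | pred i hi =>
    refine (h2 _).1 ?_
    push_cast at hi ⊢
    rwa [show (m : ℂ) + (-i - 1) * τ + τ = m + -i * τ by ring]

/-! ### The product expansion -/

/-- The infinite product `∏ₙ (1 - qⁿ u)`. -/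
def qProd (q u : ℂ) : ℂ := ∏' n : ℕ, (1 + -(q ^ n * u))

lemma summable_norm_pow_mul {q : ℂ} (hq : ‖q‖ < 1) (u : ℂ) :
    Summable fun n : ℕ => ‖-(q ^ n * u)‖ := by
  simp only [norm_neg, norm_mul, norm_pow]
  exact (summable_geometric_of_lt_one (norm_nonneg _) hq).mul_right _

lemma qProd_eq {q : ℂ} (hq : ‖q‖ < 1) (u : ℂ) : qProd q u = (1 - u) * qProd q (q * u) := by
  have h2 := (multipliable_one_add_of_summable (summable_norm_pow_mul hq (q * u)))
  rw [qProd, qProd]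
  rw [tprod_eq_zero_mul' (f := fun n : ℕ => 1 + -(q ^ n * u))]
  · congr 1
    · ring
    · refine tprod_congr fun n => ?_
      ring
  · convert h2 using 2
    ring

lemma qProd_ne_zero {q : ℂ} (hq : ‖q‖ < 1) {u : ℂ} (hu : ∀ n : ℕ, q ^ n * u ≠ 1) :
    qProd q u ≠ 0 := by
  refine tprod_one_add_ne_zero_of_summable (fun n h => hu n ?_) (summable_norm_pow_mul hq u)
  linear_combination -h

lemma differentiable_qProd {q : ℂ} (hq : ‖q‖ < 1) : Differentiable ℂ (qProd q) := by
  intro u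
  have h : HasProdLocallyUniformlyOn (fun (n : ℕ) u => 1 + -(q ^ n * u)) (qProd q)
      (Metric.ball 0 (‖u‖ + 1)) := by
    refine Summable.hasProdLocallyUniformlyOn_nat_one_add Metric.isOpen_ball
      (u := fun n => ‖q‖ ^ n * (‖u‖ + 1))
      ((summable_geometric_of_lt_one (norm_nonneg _) hq).mul_right _)
      (.of_forall fun n x hx => ?_) (fun n => by fun_prop)
    rw [norm_neg, norm_mul, norm_pow]
    have : ‖x‖ < ‖u‖ + 1 := by simpa using hx
    gcongr
  have h2 := h.differentiableOn (.of_forall fun _ ↦ by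
    simpa [Finset.prod_fn] using DifferentiableOn.finsetProd (fun _ _ ↦ by fun_prop))
    Metric.isOpen_ball
  exact h2.differentiableAt (Metric.isOpen_ball.mem_nhds (by simp))

lemma norm_exp_two_pi_mul_I_lt_one {τ : ℂ} (hτ : 0 < τ.im) :
    ‖exp (2 * Real.pi * I * τ)‖ < 1 := by
  rw [norm_exp]
  have : (2 * Real.pi * I * τ : ℂ).re = -(2 * Real.pi * τ.im) := by simp
  rw [this, Real.exp_lt_one_iff]
  have := Real.pi_pos
  nlinarith [mul_pos this hτ]

/-- Up to a constant factor, the product expansion of the theta function. -/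
def thetaProd (τ z : ℂ) : ℂ :=
  exp (-(Real.pi * I * z)) * qProd (exp (2 * Real.pi * I * τ)) (exp (2 * Real.pi * I * z))
    * qProd (exp (2 * Real.pi * I * τ)) (exp (2 * Real.pi * I * (τ - z)))

lemma differentiable_thetaProd {τ : ℂ} (hτ : 0 < τ.im) : Differentiable ℂ (thetaProd τ) := by
  have h := differentiable_qProd (norm_exp_two_pi_mul_I_lt_one hτ)
  have h1 : Differentiable ℂ fun z : ℂ => exp (2 * Real.pi * I * z) := by fun_prop
  have h2 : Differentiable ℂ fun z : ℂ => exp (2 * Real.pi * I * (τ - z)) := by fun_prop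
  have h3 : Differentiable ℂ fun z : ℂ => exp (-(Real.pi * I * z)) := by fun_prop
  exact (h3.mul (h.comp h1)).mul (h.comp h2)

lemma exp_two_pi_mul_I_eq_one_iff (z : ℂ) :
    exp (2 * Real.pi * I * z) = 1 ↔ ∃ n : ℤ, z = n := by
  rw [exp_eq_one_iff]
  refine exists_congr fun n => ?_
  have : (2 * Real.pi * I : ℂ) ≠ 0 := two_pi_I_ne_zero
  rw [mul_comm (n : ℂ)]
  exact mul_right_inj' this

lemma thetaProd_add_one (τ z : ℂ) : thetaProd τ (z + 1) = -thetaProd τ z := by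
  have e : exp (2 * Real.pi * I) = 1 := exp_two_pi_mul_I
  rw [thetaProd, thetaProd,
    show (2 * Real.pi * I * (z + 1) : ℂ) = 2 * Real.pi * I * z + 2 * Real.pi * I by ring,
    show (2 * Real.pi * I * (τ - (z + 1)) : ℂ) = 2 * Real.pi * I * (τ - z) - 2 * Real.pi * I by ring,
    exp_add, exp_sub, e, mul_one, div_one,
    show (-(Real.pi * I * (z + 1)) : ℂ) = -(Real.pi * I * z) + -(Real.pi * I) by ring, exp_add,
    exp_neg (Real.pi * I), exp_pi_mul_I]
  norm_num

/-- The translation removes the first factor of one product and adds a factor to the other; the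
ratio of these two factors gives the multiplier. -/
lemma thetaProd_add_tau {τ : ℂ} (hτ : 0 < τ.im) (z : ℂ) :
    thetaProd τ (z + τ) = -exp (-(Real.pi * I * τ) - 2 * Real.pi * I * z) * thetaProd τ z := by
  have hq := norm_exp_two_pi_mul_I_lt_one hτ
  rw [thetaProd, thetaProd, qProd_eq hq (exp (2 * Real.pi * I * z)),
    qProd_eq hq (exp (2 * Real.pi * I * (τ - (z + τ)))), ← exp_add, ← exp_add,
    show (2 * Real.pi * I * τ + 2 * Real.pi * I * z : ℂ) = 2 * Real.pi * I * (z + τ) by ring,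
    show (2 * Real.pi * I * τ + 2 * Real.pi * I * (τ - (z + τ)) : ℂ)
      = 2 * Real.pi * I * (τ - z) by ring]
  have : exp (-(Real.pi * I * (z + τ))) * (1 - exp (2 * Real.pi * I * (τ - (z + τ))))
      = -exp (-(Real.pi * I * τ) - 2 * Real.pi * I * z) * exp (-(Real.pi * I * z))
        * (1 - exp (2 * Real.pi * I * z)) := by
    rw [mul_one_sub, mul_one_sub, neg_mul, neg_mul, ← exp_add, ← exp_add, ← exp_add]
    ring_nf
  linear_combination (qProd (exp (2 * Real.pi * I * τ)) (exp (2 * Real.pi * I * (z + τ)))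
    * qProd (exp (2 * Real.pi * I * τ)) (exp (2 * Real.pi * I * (τ - z)))) * this

lemma mem_lattice_of_thetaProd_eq_zero {τ : ℂ} (hτ : 0 < τ.im) {z : ℂ} (h : thetaProd τ z = 0) :
    z ∈ lattice τ := by
  have hq := norm_exp_two_pi_mul_I_lt_one hτ
  have key : ∀ u : ℂ, qProd (exp (2 * Real.pi * I * τ)) (exp (2 * Real.pi * I * u)) = 0 →
      u ∈ lattice τ := by
    intro u hu
    by_contra hn
    refine qProd_ne_zero hq (fun n h => hn ?_) hu
    rw [← exp_nat_mul, ← exp_add,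
      show (n * (2 * Real.pi * I * τ) + 2 * Real.pi * I * u : ℂ)
        = 2 * Real.pi * I * (n * τ + u) by ring, exp_two_pi_mul_I_eq_one_iff] at h
    obtain ⟨m, hm⟩ := h
    exact ⟨m, -n, by push_cast; linear_combination hm⟩
  rw [thetaProd, mul_eq_zero, mul_eq_zero] at h
  rcases h with (h | h) | h
  · exact absurd h (exp_ne_zero _)
  · exact key _ h
  · have := add_mem_lattice (tau_mem_lattice τ) (neg_mem_lattice (key _ h))
    simpa using this

/-- The first factor 1 - exp(2πiz) has a simple zero at 0, and the cofactor `g` takes the value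
`qProd q q` squared there, which is nonzero. -/
lemma deriv_thetaProd_zero_ne_zero {τ : ℂ} (hτ : 0 < τ.im) :
    thetaProd τ 0 = 0 ∧ deriv (thetaProd τ) 0 ≠ 0 := by
  have hq := norm_exp_two_pi_mul_I_lt_one hτ
  set q := exp (2 * Real.pi * I * τ) with hqdef
  set g : ℂ → ℂ := fun z => exp (-(Real.pi * I * z)) * qProd q (q * exp (2 * Real.pi * I * z))
    * qProd q (exp (2 * Real.pi * I * (τ - z))) with hg
  have hT : thetaProd τ = fun z => (1 - exp (2 * Real.pi * I * z)) * g z := by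
    funext z
    rw [thetaProd, ← hqdef, qProd_eq hq (exp (2 * Real.pi * I * z)), hg]
    ring
  have h := differentiable_qProd hq
  have h1 : Differentiable ℂ fun z : ℂ => q * exp (2 * Real.pi * I * z) := by fun_prop
  have h2 : Differentiable ℂ fun z : ℂ => exp (2 * Real.pi * I * (τ - z)) := by fun_prop
  have h3 : Differentiable ℂ fun z : ℂ => exp (-(Real.pi * I * z)) := by fun_prop
  have hgd : Differentiable ℂ g := (h3.mul (h.comp h1)).mul (h.comp h2)
  have hq0 : qProd q q ≠ 0 := by
    refine qProd_ne_zero hq fun n hn => ?_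
    have := congrArg norm hn
    rw [← pow_succ, norm_pow, norm_one] at this
    exact absurd this (pow_lt_one₀ (norm_nonneg _) hq (by omega)).ne
  have hg0 : g 0 ≠ 0 := by
    simp only [hg, mul_zero, neg_zero, exp_zero, one_mul, mul_one, sub_zero]
    exact mul_ne_zero hq0 hq0
  have hd : HasDerivAt (fun z : ℂ => 1 - exp (2 * Real.pi * I * z)) (-(2 * Real.pi * I)) 0 := by
    have := (((hasDerivAt_id (0 : ℂ)).const_mul (2 * Real.pi * I : ℂ)).cexp).const_sub 1
    simpa using this
  have hd2 := hd.mul (hgd 0).hasDerivAt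
  refine ⟨by simp [hT], ?_⟩
  rw [hT]
  refine ne_of_eq_of_ne hd2.deriv ?_
  simpa using hg0

/-- A function satisfying the two functional equations of the theta function and having a simple
zero at the origin has simple zeros on the whole lattice. -/
lemma simple_zero_of_mem_lattice {τ : ℂ} {T : ℂ → ℂ} (hd : Differentiable ℂ T)
    (h1 : ∀ z, T (z + 1) = -T z)
    (h2 : ∀ z, T (z + τ) = -exp (-(Real.pi * I * τ) - 2 * Real.pi * I * z) * T z)
    (h0 : T 0 = 0) (h0' : deriv T 0 ≠ 0) {w : ℂ} (hw : w ∈ lattice τ) :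
    T w = 0 ∧ deriv T w ≠ 0 := by
  have e1 : ∀ z, T z = 0 → T (z + 1) = 0 ∧ deriv T (z + 1) = -deriv T z := by
    intro z hz
    refine ⟨by rw [h1, hz, neg_zero], ?_⟩
    rw [← deriv_comp_add_const T 1 z]
    simp_rw [funext h1]
    exact deriv.fun_neg
  -- At a zero of `T` the term containing the derivative of the multiplier drops out.
  have e2 : ∀ z, T z = 0 → T (z + τ) = 0 ∧
      deriv T (z + τ) = -exp (-(Real.pi * I * τ) - 2 * Real.pi * I * z) * deriv T z := by
    intro z hz
    refine ⟨by rw [h2, hz, mul_zero], ?_⟩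
    rw [← deriv_comp_add_const T τ z]
    simp_rw [funext h2]
    have hE : DifferentiableAt ℂ
      (fun z : ℂ => -exp (-(Real.pi * I * τ) - 2 * Real.pi * I * z)) z := by fun_prop
    rw [deriv_fun_mul hE (hd z), hz, mul_zero, zero_add]
  refine lattice_induction (p := fun w => T w = 0 ∧ deriv T w ≠ 0) ⟨h0, h0'⟩ ?_ ?_ hw
  · intro z
    have : T (z + 1) = 0 ↔ T z = 0 := by rw [h1, neg_eq_zero]
    rw [this]
    refine and_congr_right fun hz => ?_
    rw [(e1 z hz).2, neg_ne_zero]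
  · intro z
    have : T (z + τ) = 0 ↔ T z = 0 := by simp [h2, exp_ne_zero]
    rw [this]
    refine and_congr_right fun hz => ?_
    rw [(e2 z hz).2]
    simp [exp_ne_zero]

lemma thetaProd_eq_zero_iff {τ : ℂ} (hτ : 0 < τ.im) {z : ℂ} :
    thetaProd τ z = 0 ↔ z ∈ lattice τ :=
  ⟨mem_lattice_of_thetaProd_eq_zero hτ, fun h =>
    (simple_zero_of_mem_lattice (differentiable_thetaProd hτ) (thetaProd_add_one τ)
      (thetaProd_add_tau hτ) (deriv_thetaProd_zero_ne_zero hτ).1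
      (deriv_thetaProd_zero_ne_zero hτ).2 h).1⟩

lemma deriv_thetaProd_ne_zero {τ : ℂ} (hτ : 0 < τ.im) {z : ℂ} (h : thetaProd τ z = 0) :
    deriv (thetaProd τ) z ≠ 0 :=
  (simple_zero_of_mem_lattice (differentiable_thetaProd hτ) (thetaProd_add_one τ)
    (thetaProd_add_tau hτ) (deriv_thetaProd_zero_ne_zero hτ).1
    (deriv_thetaProd_zero_ne_zero hτ).2 (mem_lattice_of_thetaProd_eq_zero hτ h)).2

/-! ### Division of entire functions of several variables -/

/-- An entire function on a finite-dimensional space that vanishes wherever `φ (ℓ z + c)` does, where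
`φ` has only simple zeros, is divisible by `φ (ℓ z + c)`. -/
lemma exists_differentiable_mul_eq {E : Type*} [NormedAddCommGroup E] [NormedSpace ℂ E]
    [FiniteDimensional ℂ E] {φ : ℂ → ℂ} (hφ : Differentiable ℂ φ)
    (hφ' : ∀ w, φ w = 0 → deriv φ w ≠ 0) (ℓ : E →L[ℂ] ℂ) (c : ℂ) {v : E} (hv : ℓ v = 1)
    {G : E → ℂ} (hG : Differentiable ℂ G) (h0 : ∀ z, φ (ℓ z + c) = 0 → G z = 0) :
    ∃ H : E → ℂ, Differentiable ℂ H ∧ ∀ z, G z = φ (ℓ z + c) * H z := by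
  have : ProperSpace E := FiniteDimensional.proper ℂ E
  borelize E
  set L : E → ℂ := fun z => ℓ z + c with hL
  have hLd : Differentiable ℂ L := by fun_prop
  have hLv : ∀ z s, L (z + s • v) = L z + s := fun z s => by simp [hL, hv]; ring
  classical
  -- On the zero locus the quotient is defined by l'Hôpital's rule along `v`, a direction
  -- transversal to that locus.
  set H : E → ℂ := fun z =>
    if φ (L z) = 0 then fderiv ℂ G z v / deriv φ (L z) else G z / φ (L z) with hH
  have hmul : ∀ z, G z = φ (L z) * H z := by
    intro z
    by_cases hz : φ (L z) = 0
    · rw [h0 z hz, hz, zero_mul]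
    · simp only [hH, if_neg hz]
      field_simp
  have hreg : ∀ z, φ (L z) ≠ 0 → DifferentiableAt ℂ H z := by
    intro z hz
    have h1 : DifferentiableAt ℂ (fun z => φ (L z)) z := (hφ.comp hLd) z
    refine DifferentiableAt.congr_of_eventuallyEq ((hG z).mul (h1.fun_inv hz)) ?_
    filter_upwards [h1.continuousAt.eventually_ne hz] with y hy
    simp only [hH, if_neg hy, Pi.mul_apply, div_eq_mul_inv]
  have hiso : ∀ w, φ w = 0 → ∀ᶠ s in 𝓝[≠] w, φ s ≠ 0 := fun w hw =>
    (hφ w).hasDerivAt.eventually_ne (hφ' w hw)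
  -- On each line in the direction `v` the quotient is a ratio of two `dslope`s with nonvanishing
  -- denominator, hence holomorphic.
  have hslice : ∀ z, DifferentiableAt ℂ (fun s : ℂ => H (z + s • v)) 0 := by
    intro z
    by_cases hz : φ (L z) = 0
    · have hg : Differentiable ℂ (fun s : ℂ => G (z + s • v)) :=
        hG.comp (by fun_prop)
      have hf : Differentiable ℂ (fun s : ℂ => φ (L z + s)) := hφ.comp (by fun_prop)
      have hg' := (differentiableOn_dslope (f := fun s : ℂ => G (z + s • v)) (c := 0)
        Filter.univ_mem).2 hg.differentiableOn
      have hf' := (differentiableOn_dslope (f := fun s : ℂ => φ (L z + s)) (c := 0)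
        Filter.univ_mem).2 hf.differentiableOn
      have hdf : deriv (fun s : ℂ => φ (L z + s)) 0 = deriv φ (L z) := by
        rw [deriv_comp_const_add φ (L z) 0, add_zero]
      have hdg : deriv (fun s : ℂ => G (z + s • v)) 0 = fderiv ℂ G z v := by
        have h1 : HasDerivAt (fun s : ℂ => z + s • v) v 0 := by
          simpa using ((hasDerivAt_id (0 : ℂ)).smul_const v).const_add z
        have h2 : HasFDerivAt G (fderiv ℂ G z) (z + (0 : ℂ) • v) := by
          simpa using (hG z).hasFDerivAt
        exact (h2.comp_hasDerivAt (0 : ℂ) h1).deriv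
      have hq : DifferentiableAt ℂ (fun s => dslope (fun s : ℂ => G (z + s • v)) 0 s /
          dslope (fun s : ℂ => φ (L z + s)) 0 s) 0 := by
        refine (hg'.differentiableAt Filter.univ_mem).div
          (hf'.differentiableAt Filter.univ_mem) ?_
        rw [dslope_same, hdf]
        exact hφ' _ hz
      refine hq.congr_of_eventuallyEq ?_
      have hev : ∀ᶠ s in 𝓝[≠] (0 : ℂ), φ (L z + s) ≠ 0 := by
        have : HasDerivAt (fun s : ℂ => φ (L z + s)) (deriv φ (L z)) 0 :=
          hdf ▸ (hf 0).hasDerivAt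
        exact this.eventually_ne (hφ' _ hz)
      rw [eventually_nhdsWithin_iff] at hev
      filter_upwards [hev] with s hs
      by_cases hs0 : s = 0
      · subst hs0
        simp only [dslope_same, hdf, hdg, hH, zero_smul, add_zero, if_pos hz]
      · have hne := hs hs0
        rw [dslope_of_ne _ hs0, dslope_of_ne _ hs0, slope_def_field, slope_def_field]
        simp only [hH, hLv, if_neg hne, zero_smul, add_zero, sub_zero, hz, h0 z hz]
        field_simp
    · refine DifferentiableAt.comp (0 : ℂ) (g := H) (f := fun s : ℂ => z + s • v) ?_ (by fun_prop)
      simpa using hreg z hz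
  have hslice' : ∀ z, Differentiable ℂ (fun s : ℂ => H (z + s • v)) := by
    intro z s
    have h1 := hslice (z + s • v)
    have h2 : DifferentiableAt ℂ (fun t : ℂ => H (z + s • v + (t - s) • v)) s :=
      DifferentiableAt.comp s (g := fun t : ℂ => H (z + s • v + t • v)) (f := fun t : ℂ => t - s)
        (by simpa using h1) (by fun_prop)
    refine h2.congr_of_eventuallyEq (.of_forall fun t => ?_)
    simp only [sub_smul]
    congr 1
    abel
  refine ⟨H, fun z₀ => ?_, hmul⟩
  by_cases hz₀ : φ (L z₀) = 0
  swap
  · exact hreg z₀ hz₀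
  -- To pass from slices to joint differentiability, `H` near `z₀` is expressed as its mean over
  -- circles of radius `r` in the direction `v`. With `r = ε / 2` and |ℓ(z - z₀)| < `r`, these
  -- circles avoid the zero locus, so `H` is already known to be differentiable on them.
  obtain ⟨ε, hε, hball⟩ := Metric.mem_nhdsWithin_iff.1 (hiso _ hz₀)
  set r := ε / 2 with hr
  have hrpos : 0 < r := by positivity
  obtain ⟨δ, hδ, hδr⟩ : ∃ δ > 0, ‖ℓ‖ * (2 * δ) < r := by
    refine ⟨r / (2 * (‖ℓ‖ + 1)), by positivity, ?_⟩
    have : 0 ≤ ‖ℓ‖ := norm_nonneg _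
    rw [show ‖ℓ‖ * (2 * (r / (2 * (‖ℓ‖ + 1)))) = r * (‖ℓ‖ / (‖ℓ‖ + 1)) by field_simp]
    have : ‖ℓ‖ / (‖ℓ‖ + 1) < 1 := by rw [div_lt_one (by positivity)]; linarith
    nlinarith
  have hne : ∀ z ∈ Metric.closedBall z₀ (2 * δ), ∀ s ∈ Metric.sphere (0 : ℂ) r,
      φ (L (z + s • v)) ≠ 0 := by
    intro z hz s hs
    have hs' : ‖s‖ = r := by simpa using hs
    have hd : ‖ℓ (z - z₀)‖ < r := by
      refine lt_of_le_of_lt ((ℓ.le_opNorm _).trans ?_) hδr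
      gcongr
      simpa [dist_eq_norm] using hz
    have he : L (z + s • v) - L z₀ = ℓ (z - z₀) + s := by
      rw [hLv, hL]
      simp only [map_sub]
      ring
    refine hball ⟨?_, ?_⟩
    · rw [Metric.mem_ball, dist_eq_norm, he]
      refine (norm_add_le _ _).trans_lt ?_
      rw [hs', hr] at *
      linarith
    · simp only [Set.mem_compl_iff, Set.mem_singleton_iff]
      intro h
      rw [h, sub_self] at he
      have : s = -ℓ (z - z₀) := by linear_combination -he
      rw [this, norm_neg] at hs'
      exact absurd hs' hd.ne
  have hmem : ∀ θ, circleMap 0 r θ ∈ Metric.sphere (0 : ℂ) r := fun θ =>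
    circleMap_mem_sphere 0 hrpos.le θ
  have havg : ∀ z, H z = (2 * Real.pi)⁻¹ • ∫ θ in (0)..2 * Real.pi, H (z + circleMap 0 r θ • v) := by
    intro z
    have := DiffContOnCl.circleAverage (f := fun s : ℂ => H (z + s • v)) (c := 0) (R := r)
      (hslice' z).diffContOnCl
    rw [Real.circleAverage_def] at this
    simpa using this.symm
  have hcont : ∀ z ∈ Metric.closedBall z₀ (2 * δ),
      Continuous fun θ => H (z + circleMap 0 r θ • v) := by
    intro z hz
    refine continuous_iff_continuousAt.2 fun θ => ?_
    have h1 := (hreg _ (hne z hz _ (hmem θ))).continuousAt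
    exact ContinuousAt.comp (g := H) (f := fun θ => z + circleMap 0 r θ • v) h1
      (by fun_prop)
  obtain ⟨M, hM⟩ : ∃ M, ∀ z ∈ Metric.closedBall z₀ (2 * δ), ∀ θ,
      ‖H (z + circleMap 0 r θ • v)‖ ≤ M := by
    set S := (fun p : E × ℂ => p.1 + p.2 • v) ''
      (Metric.closedBall z₀ (2 * δ) ×ˢ Metric.sphere (0 : ℂ) r) with hS
    have hSc : IsCompact S := ((isCompact_closedBall _ _).prod (isCompact_sphere _ _)).image
      (by fun_prop)
    have hSH : ContinuousOn H S := by
      rintro _ ⟨⟨z, s⟩, ⟨hz, hs⟩, rfl⟩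
      exact (hreg _ (hne z hz s hs)).continuousAt.continuousWithinAt
    obtain ⟨M, hM⟩ := hSc.exists_bound_of_continuousOn hSH
    exact ⟨M, fun z hz θ => hM _ ⟨(z, circleMap 0 r θ), ⟨hz, hmem θ⟩, rfl⟩⟩
  have hsub : Metric.ball z₀ δ ⊆ Metric.closedBall z₀ (2 * δ) := fun z hz => by
    rw [Metric.mem_closedBall]
    have := Metric.mem_ball.1 hz
    linarith
  have hdiff : ∀ θ, ∀ z ∈ Metric.closedBall z₀ (2 * δ),
      HasFDerivAt (fun z => H (z + circleMap 0 r θ • v))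
        (fderiv ℂ H (z + circleMap 0 r θ • v)) z := by
    intro θ z hz
    exact (hasFDerivAt_comp_add_right (f := H) (circleMap 0 r θ • v)).2
      (hreg _ (hne z hz _ (hmem θ))).hasFDerivAt
  -- Differentiation under the mean value integral. The bound is a Cauchy estimate on balls of
  -- radius `δ` around points of the `δ`-ball, which is why the circles were controlled on radius `2
  -- * δ`.
  have key := intervalIntegral.hasFDerivAt_integral_of_dominated_of_fderiv_le
    (𝕜 := ℂ) (μ := MeasureTheory.volume) (a := 0) (b := 2 * Real.pi)
    (F := fun z θ => H (z + circleMap 0 r θ • v))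
    (F' := fun z θ => fderiv ℂ H (z + circleMap 0 r θ • v)) (x₀ := z₀)
    (bound := fun _ => (2 * M) / δ)
    (Metric.ball_mem_nhds z₀ hδ)
    (by
      filter_upwards [Metric.ball_mem_nhds z₀ hδ] with z hz
      exact (hcont z (hsub hz)).aestronglyMeasurable)
    ((hcont z₀ (hsub (Metric.mem_ball_self hδ))).intervalIntegrable _ _)
    (by
      have : Measurable fun θ => fderiv ℂ H (z₀ + circleMap 0 r θ • v) :=
        (measurable_fderiv ℂ H).comp (by fun_prop : Continuous fun θ =>
          z₀ + circleMap 0 r θ • v).measurable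
      exact this.aestronglyMeasurable)
    (by
      refine .of_forall fun θ _ z hz => ?_
      rw [← (hdiff θ z (hsub hz)).fderiv]
      have hb : Metric.ball z δ ⊆ Metric.closedBall z₀ (2 * δ) := fun y hy => by
        rw [Metric.mem_closedBall]
        have h1 := Metric.mem_ball.1 hz
        have h2 := Metric.mem_ball.1 hy
        have := dist_triangle y z z₀
        linarith
      refine norm_fderiv_le_div_of_mapsTo_ball
        (fun y hy => (hdiff θ y (hb hy)).differentiableAt.differentiableWithinAt) (fun y hy => ?_) hδ
      rw [Metric.mem_closedBall, dist_eq_norm]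
      refine (norm_sub_le _ _).trans ?_
      have h1 := hM y (hb hy) θ
      have h2 := hM z (hsub hz) θ
      linarith)
    intervalIntegrable_const
    (.of_forall fun θ _ z hz => hdiff θ z (hsub hz))
  have h2 := key.const_smul ((2 * Real.pi)⁻¹ : ℝ)
  refine (h2.differentiableAt).congr_of_eventuallyEq (.of_forall fun z => ?_)
  exact havg z

/-- Two continuous functions agree at a point if they agree at the nearby points of a line through
it. -/
lemma eq_of_eventually_line {E : Type*} [NormedAddCommGroup E] [NormedSpace ℂ E] {A B : E → ℂ}
    (hA : Continuous A) (hB : Continuous B) (v z : E)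
    (h : ∀ᶠ s : ℂ in 𝓝[≠] 0, A (z + s • v) = B (z + s • v)) : A z = B z := by
  have hlim : ∀ {C : E → ℂ}, Continuous C →
      Tendsto (fun s : ℂ => C (z + s • v)) (𝓝[≠] 0) (𝓝 (C z)) := by
    intro C hC
    have : Continuous fun s : ℂ => C (z + s • v) := hC.comp (by fun_prop)
    have h2 := this.tendsto 0
    simp only [zero_smul, add_zero] at h2
    exact h2.mono_left nhdsWithin_le_nhds
  exact tendsto_nhds_unique_of_eventuallyEq (hlim hA) (hlim hB) h

/-! ### The zeros of the theta function -/

lemma eventually_thetaProd_ne_zero {τ : ℂ} (hτ : 0 < τ.im) (w : ℂ) :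
    ∀ᶠ s in 𝓝[≠] w, thetaProd τ s ≠ 0 := by
  by_cases hw : thetaProd τ w = 0
  · exact ((differentiable_thetaProd hτ) w).hasDerivAt.eventually_ne (deriv_thetaProd_ne_zero hτ hw)
  · exact ((differentiable_thetaProd hτ) w).continuousAt.eventually_ne hw |>.filter_mono
      nhdsWithin_le_nhds

/-- The lattice is discrete: an affine function of one variable takes values outside of it near any
given point. -/
lemma eventually_notMem_lattice {τ : ℂ} (hτ : 0 < τ.im) (w : ℂ) {c : ℂ} (hc : c ≠ 0) :
    ∀ᶠ s in 𝓝[≠] (0 : ℂ), w + s * c ∉ lattice τ := by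
  have h1 : Tendsto (fun s : ℂ => w + s * c) (𝓝[≠] 0) (𝓝[≠] w) := by
    refine tendsto_nhdsWithin_iff.2 ⟨?_, ?_⟩
    · have : Continuous fun s : ℂ => w + s * c := by fun_prop
      simpa using (this.tendsto 0).mono_left nhdsWithin_le_nhds
    · filter_upwards [self_mem_nhdsWithin] with s hs
      simpa using ⟨hs, hc⟩
  filter_upwards [h1.eventually (eventually_thetaProd_ne_zero hτ w)] with s hs h
  exact hs ((thetaProd_eq_zero_iff hτ).2 h)

lemma exists_add_lattice_mem {τ : ℂ} (hτ : 0 < τ.im) (z : ℂ) :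
    ∃ m n : ℤ, ∃ a ∈ Set.Icc (0 : ℝ) 1, ∃ b ∈ Set.Icc (0 : ℝ) 1, z = (a + b * τ) + m + n * τ := by
  set y : ℝ := z.im / τ.im with hy
  set x : ℝ := z.re - y * τ.re with hx
  have hz : z = x + y * τ := by
    apply Complex.ext
    · simp [hx]
    · simp [hy]
      field_simp
  refine ⟨⌊x⌋, ⌊y⌋, Int.fract x, ⟨Int.fract_nonneg _, (Int.fract_lt_one _).le⟩,
    Int.fract y, ⟨Int.fract_nonneg _, (Int.fract_lt_one _).le⟩, ?_⟩
  have e1 : (x : ℂ) = (⌊x⌋ : ℂ) + (Int.fract x : ℝ) := by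
    exact_mod_cast (Int.floor_add_fract x).symm
  have e2 : (y : ℂ) = (⌊y⌋ : ℂ) + (Int.fract y : ℝ) := by
    exact_mod_cast (Int.floor_add_fract y).symm
  rw [hz, e1, e2]
  ring

/-- All values are taken on a compact period parallelogram, so Liouville's theorem applies. -/
lemma doubly_periodic_const {τ : ℂ} (hτ : 0 < τ.im) {f : ℂ → ℂ} (hf : Differentiable ℂ f)
    (h1 : ∀ z, f (z + 1) = f z) (h2 : ∀ z, f (z + τ) = f z) (z w : ℂ) : f z = f w := by
  refine hf.apply_eq_apply_of_bounded ?_ z w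
  have hK : IsCompact ((fun p : ℝ × ℝ => f (p.1 + p.2 * τ)) '' (Set.Icc 0 1 ×ˢ Set.Icc 0 1)) := by
    refine (isCompact_Icc.prod isCompact_Icc).image ?_
    exact hf.continuous.comp (by fun_prop)
  refine hK.isBounded.subset ?_
  rintro _ ⟨z, rfl⟩
  obtain ⟨m, n, a, ha, b, hb, rfl⟩ := exists_add_lattice_mem hτ z
  refine ⟨(a, b), ⟨ha, hb⟩, ?_⟩
  have : ∀ w ∈ lattice τ, ∀ u, f (u + w) = f u := fun w hw =>
    lattice_induction (p := fun w => ∀ u, f (u + w) = f u) (by simp)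
      (fun z => forall_congr' fun u => by rw [← add_assoc, h1])
      (fun z => forall_congr' fun u => by rw [← add_assoc, h2]) hw
  simp only
  rw [add_assoc _ (m : ℂ), this _ ⟨m, n, rfl⟩]

/-- The theta function is a constant multiple of the product. -/
lemma exists_theta1_eq_mul_thetaProd {τ : ℂ} (hτ : 0 < τ.im) :
    ∃ C : ℂ, ∀ z, theta1 z τ = C * thetaProd τ z := by
  have hz : ∀ w ∈ lattice τ, theta1 w τ = 0 := fun w hw =>
    lattice_induction (p := fun w => theta1 w τ = 0) (theta1_zero τ)
      (fun z => by rw [theta1_add_one, neg_eq_zero])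
      (fun z => by simp [theta1_add_tau, Complex.exp_ne_zero]) hw
  obtain ⟨H, hH, hmul⟩ := exists_differentiable_mul_eq (differentiable_thetaProd hτ)
    (fun w => deriv_thetaProd_ne_zero hτ) (ContinuousLinearMap.id ℂ ℂ) 0 (v := 1) (by simp)
    (differentiable_theta1 hτ)
    (fun z h => hz z ((thetaProd_eq_zero_iff hτ).1 (by simpa using h)))
  simp only [ContinuousLinearMap.id_apply, add_zero] at hmul
  -- Equal multipliers of numerator and denominator cancel off the lattice, and continuity extends
  -- the periodicity of the quotient to the lattice.
  have hper : ∀ c : ℂ → ℂ, ∀ ω : ℂ, (∀ z, c z ≠ 0) →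
      (∀ z, theta1 (z + ω) τ = c z * theta1 z τ) →
      (∀ z, thetaProd τ (z + ω) = c z * thetaProd τ z) → ∀ z, H (z + ω) = H z := by
    intro c ω hc h1 h2 z
    refine eq_of_eventually_line (A := fun z => H (z + ω)) (B := H)
      (hH.continuous.comp (by fun_prop)) hH.continuous 1 z ?_
    filter_upwards [eventually_notMem_lattice hτ z one_ne_zero] with s hs
    have hs' : thetaProd τ (z + s • 1) ≠ 0 := fun h => hs (by
      simpa using (thetaProd_eq_zero_iff hτ).1 h)
    have h3 := h1 (z + s • 1)
    rw [hmul, hmul, h2] at h3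
    have h4 : (c (z + s • 1) * thetaProd τ (z + s • 1)) ≠ 0 := mul_ne_zero (hc _) hs'
    exact mul_left_cancel₀ h4 (by linear_combination h3)
  have hconst := doubly_periodic_const hτ hH
    (hper (fun _ => -1) 1 (by simp) (by simp [theta1_add_one]) (by simp [thetaProd_add_one]))
    (hper (fun z => -exp (-(Real.pi * I * τ) - 2 * Real.pi * I * z)) τ
      (by simp [Complex.exp_ne_zero]) (fun z => theta1_add_tau z τ) (thetaProd_add_tau hτ))
  exact ⟨H 0, fun z => by rw [hmul, hconst z 0, mul_comm]⟩

/-- The hypothesis `ht` forces the constant relating ϑ₁ to `thetaProd` to be nonzero. -/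
lemma theta1_simple_zeros {τ : ℂ} (hτ : 0 < τ.im) (ht : deriv (fun x => theta1 x τ) 0 ≠ 0) :
    (∀ z, theta1 z τ = 0 ↔ z ∈ lattice τ) ∧
      ∀ z, theta1 z τ = 0 → deriv (fun x => theta1 x τ) z ≠ 0 := by
  obtain ⟨C, hC⟩ := exists_theta1_eq_mul_thetaProd hτ
  have hC0 : C ≠ 0 := by
    rintro rfl
    simp [hC] at ht
  have h1 : ∀ z, theta1 z τ = 0 ↔ z ∈ lattice τ := fun z => by
    rw [hC, mul_eq_zero, or_iff_right hC0, thetaProd_eq_zero_iff hτ]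
  refine ⟨h1, fun z hz => ?_⟩
  exact (simple_zero_of_mem_lattice (differentiable_theta1 hτ) (fun z => theta1_add_one z τ)
    (fun z => theta1_add_tau z τ) (theta1_zero τ) ht ((h1 z).1 hz)).2

/-! ### The Weierstrass three-term identity -/

/-- The `m`-th summand of the negative of the theta function. -/
def thetaTerm (τ : ℂ) (m : ℤ) (z : ℂ) : ℂ :=
  exp (I * Real.pi * ((m : ℂ) + 1 / 2) ^ 2 * τ
      + 2 * Real.pi * I * ((m : ℂ) + 1 / 2) * (z + 1 / 2))

/-- The exponential `exp (2 π i τ j² + 4 π i j x)` at an integer `j`. -/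
def evenTerm (τ : ℂ) (j : ℤ) (x : ℂ) : ℂ :=
  exp (2 * Real.pi * I * τ * (j : ℂ) ^ 2 + 4 * Real.pi * I * j * x)

/-- The exponential `exp (2 π i τ j² + 4 π i j x)` at the half-integer `j + 1 / 2`. -/
def oddTerm (τ : ℂ) (j : ℤ) (x : ℂ) : ℂ :=
  exp (2 * Real.pi * I * τ * ((j : ℂ) + 1 / 2) ^ 2 + 4 * Real.pi * I * ((j : ℂ) + 1 / 2) * x)

lemma summable_norm_of_eq_mul_jacobiTheta₂_term {τ : ℂ} (hτ : 0 < τ.im) {f : ℤ → ℂ} (c z : ℂ)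
    (h : ∀ m, f m = c * jacobiTheta₂_term m z τ) : Summable fun m => ‖f m‖ := by
  simp only [h, norm_mul]
  exact ((summable_jacobiTheta₂_term_iff z τ).2 hτ).norm.mul_left _

lemma summable_norm_thetaTerm {τ : ℂ} (hτ : 0 < τ.im) (z : ℂ) :
    Summable fun m => ‖thetaTerm τ m z‖ := by
  refine summable_norm_of_eq_mul_jacobiTheta₂_term hτ
    (exp (Real.pi * I * τ / 4 + Real.pi * I * (z + 1 / 2))) (z + 1 / 2 + τ / 2) fun m => ?_
  rw [jacobiTheta₂_term, thetaTerm, ← exp_add]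
  congr 1
  ring

lemma two_mul_im_pos {τ : ℂ} (hτ : 0 < τ.im) : 0 < (2 * τ).im := by
  simpa using hτ

lemma summable_norm_evenTerm {τ : ℂ} (hτ : 0 < τ.im) (x : ℂ) :
    Summable fun m => ‖evenTerm τ m x‖ := by
  refine summable_norm_of_eq_mul_jacobiTheta₂_term (two_mul_im_pos hτ) 1 (2 * x) fun m => ?_
  rw [jacobiTheta₂_term, evenTerm, one_mul]
  congr 1
  ring

lemma summable_norm_oddTerm {τ : ℂ} (hτ : 0 < τ.im) (x : ℂ) :
    Summable fun m => ‖oddTerm τ m x‖ := by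
  refine summable_norm_of_eq_mul_jacobiTheta₂_term (two_mul_im_pos hτ)
    (exp (Real.pi * I * τ / 2 + 2 * Real.pi * I * x)) (2 * x + τ) fun m => ?_
  rw [jacobiTheta₂_term, oddTerm, ← exp_add]
  congr 1
  ring

/-- Pairs of integers according to the parity of their difference. -/
def pairEquiv : (ℤ × ℤ) ⊕ (ℤ × ℤ) ≃ ℤ × ℤ where
  toFun := Sum.elim (fun p => (p.1 + p.2, p.1 - p.2)) (fun p => (p.1 + p.2, p.1 - p.2 - 1))
  invFun p := if (p.1 - p.2) % 2 = 0 then Sum.inl ((p.1 + p.2) / 2, (p.1 - p.2) / 2)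
    else Sum.inr ((p.1 + p.2 + 1) / 2, (p.1 - p.2 - 1) / 2)
  left_inv := by
    rintro (⟨l, j⟩ | ⟨l, j⟩)
    · refine (if_pos (show (l + j - (l - j)) % 2 = 0 by omega)).trans ?_
      simp only [Sum.elim_inl, Sum.inl.injEq, Prod.mk.injEq]
      omega
    · refine (if_neg (show ¬ (l + j - (l - j - 1)) % 2 = 0 by omega)).trans ?_
      simp only [Sum.elim_inr, Sum.inr.injEq, Prod.mk.injEq]
      omega
  right_inv := by
    rintro ⟨m, n⟩
    by_cases h : (m - n) % 2 = 0
    · simp only [if_pos h, Sum.elim_inl, Prod.mk.injEq]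
      omega
    · simp only [if_neg h, Sum.elim_inr, Prod.mk.injEq]
      omega

/-- The addition formula of the theta function. -/
lemma theta1_add_mul_theta1_sub {τ : ℂ} (hτ : 0 < τ.im) (x y : ℂ) :
    theta1 (x + y) τ * theta1 (x - y) τ
      = (∑' j, evenTerm τ j x) * (∑' j, oddTerm τ j y)
        - (∑' j, oddTerm τ j x) * (∑' j, evenTerm τ j y) := by
  have h1 : theta1 (x + y) τ * theta1 (x - y) τ
      = ∑' p : ℤ × ℤ, thetaTerm τ p.1 (x + y) * thetaTerm τ p.2 (x - y) := by
    rw [← tsum_mul_tsum_of_summable_norm (summable_norm_thetaTerm hτ (x + y))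
      (summable_norm_thetaTerm hτ (x - y)), theta1, theta1, neg_mul_neg]
    rfl
  -- In terms of the half-integer exponents, half-sum and half-difference are l + 1/2 and j here,
  -- but l and j + 1/2 in `he`. The factor exp(πi · sum of the exponents) is therefore -1 here and 1
  -- there, and the witness `l` counts the full turns.
  have ho : ∀ l j : ℤ, thetaTerm τ (l + j) (x + y) * thetaTerm τ (l - j) (x - y)
      = -(oddTerm τ l x * evenTerm τ j y) := by
    intro l j
    rw [thetaTerm, thetaTerm, oddTerm, evenTerm, ← exp_add, ← exp_add, ← neg_one_mul (exp _),
      ← exp_pi_mul_I, ← exp_add, exp_eq_exp_iff_exists_int]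
    refine ⟨l, ?_⟩
    push_cast
    ring
  have he : ∀ l j : ℤ, thetaTerm τ (l + j) (x + y) * thetaTerm τ (l - j - 1) (x - y)
      = evenTerm τ l x * oddTerm τ j y := by
    intro l j
    rw [thetaTerm, thetaTerm, oddTerm, evenTerm, ← exp_add, ← exp_add, exp_eq_exp_iff_exists_int]
    refine ⟨l, ?_⟩
    push_cast
    ring
  have hso := summable_mul_of_summable_norm (summable_norm_oddTerm hτ x) (summable_norm_evenTerm hτ y)
  have hse := summable_mul_of_summable_norm (summable_norm_evenTerm hτ x) (summable_norm_oddTerm hτ y)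
  rw [h1, ← pairEquiv.tsum_eq, Summable.tsum_sum]
  · simp only [pairEquiv, Equiv.coe_fn_mk, Sum.elim_inl, Sum.elim_inr, ho, he]
    rw [tsum_neg, ← tsum_mul_tsum_of_summable_norm (summable_norm_oddTerm hτ x)
      (summable_norm_evenTerm hτ y), ← tsum_mul_tsum_of_summable_norm (summable_norm_evenTerm hτ x)
      (summable_norm_oddTerm hτ y)]
    ring
  · exact (hso.neg).congr fun p => (ho p.1 p.2).symm
  · exact hse.congr fun p => (he p.1 p.2).symm

/-- The Weierstrass three-term identity. -/
lemma theta1_three_term {τ : ℂ} (hτ : 0 < τ.im) (x y z w : ℂ) :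
    theta1 (x + y) τ * theta1 (x - y) τ * (theta1 (z + w) τ * theta1 (z - w) τ)
      + theta1 (x + z) τ * theta1 (x - z) τ * (theta1 (w + y) τ * theta1 (w - y) τ)
      + theta1 (x + w) τ * theta1 (x - w) τ * (theta1 (y + z) τ * theta1 (y - z) τ) = 0 := by
  -- Each product of two theta values becomes a 2×2 minor of the matrix of even and odd sums; the
  -- claim is the Plücker relation between these minors.
  simp only [theta1_add_mul_theta1_sub hτ]
  ring

/-! ### Identities between the coefficients -/

lemma sigma_eq (w z τ : ℂ) :
    sigma w z τ
      = -(theta1 (z - w) τ * deriv (fun x => theta1 x τ) 0 / (theta1 z τ * theta1 w τ)) := by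
  rw [sigma, theta1_neg, mul_neg, div_neg]

/-- Fay's trisecant identity. -/
lemma sigma_mul_sigma {τ : ℂ} (hτ : 0 < τ.im) {ξ η u v : ℂ} (hξ : theta1 ξ τ ≠ 0)
    (hη : theta1 η τ ≠ 0) (hξη : theta1 (ξ + η) τ ≠ 0) (hu : theta1 u τ ≠ 0)
    (hv : theta1 v τ ≠ 0) (huv : theta1 (u - v) τ ≠ 0) :
    sigma ξ u τ * sigma η v τ
      = sigma (ξ + η) u τ * sigma η (v - u) τ + sigma (ξ + η) v τ * sigma ξ (u - v) τ := by
  have W : theta1 (u - ξ) τ * theta1 (ξ + η) τ * (theta1 (v - η) τ * theta1 (u - v) τ)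
      + theta1 u τ * theta1 η τ * (theta1 (v - (ξ + η)) τ * theta1 (-(u - v - ξ)) τ)
      + theta1 v τ * theta1 (-(v - u - η)) τ * (theta1 (u - (ξ + η)) τ * theta1 (-ξ) τ) = 0 := by
    -- These arguments solve x + y = u - ξ, x - y = ξ + η, z + w = v - η, z - w = u - v.
    convert theta1_three_term hτ ((u + η) / 2) ((u - 2 * ξ - η) / 2) ((u - η) / 2)
      ((2 * v - u - η) / 2) using 6 <;> ring
  have huv' : theta1 (v - u) τ = -theta1 (u - v) τ := by rw [← theta1_neg, neg_sub]
  simp only [theta1_neg] at W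
  simp only [sigma_eq, huv']
  generalize deriv (fun x => theta1 x τ) 0 = t
  field_simp
  linear_combination t ^ 2 * W

/-- Classically σ_μ(a)σ_μ(-a) = ℘(μ) - ℘(a), so μ cancels in the difference. Here this is the
three-term identity with last argument 0. -/
lemma sigma_mul_sigma_neg_sub {τ : ℂ} (hτ : 0 < τ.im) {μ a b : ℂ} (hμ : theta1 μ τ ≠ 0)
    (ha : theta1 a τ ≠ 0) (hb : theta1 b τ ≠ 0) :
    sigma μ a τ * sigma μ (-a) τ - sigma μ b τ * sigma μ (-b) τ
      = theta1 (a + b) τ * theta1 (a - b) τ * deriv (fun x => theta1 x τ) 0 ^ 2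
        / (theta1 a τ ^ 2 * theta1 b τ ^ 2) := by
  have W := theta1_three_term hτ a μ b 0
  have ea : theta1 (-a - μ) τ = -theta1 (a + μ) τ := by rw [← theta1_neg]; ring_nf
  have eb : theta1 (-b - μ) τ = -theta1 (μ + b) τ := by rw [← theta1_neg]; ring_nf
  have ec : theta1 (μ - b) τ = -theta1 (b - μ) τ := by rw [← theta1_neg]; ring_nf
  simp only [zero_add, zero_sub, add_zero, sub_zero, theta1_neg, ec] at W
  simp only [sigma_eq, theta1_neg, ea, eb]
  generalize deriv (fun x => theta1 x τ) 0 = t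
  field_simp
  linear_combination t ^ 2 * W

/-- The four-term identity between products of three coefficients. -/
lemma sigma_four_term {τ : ℂ} (hτ : 0 < τ.im) {μ ξ η a b : ℂ} (hμ : theta1 μ τ ≠ 0)
    (hξ : theta1 ξ τ ≠ 0) (hη : theta1 η τ ≠ 0) (hξη : theta1 (ξ + η) τ ≠ 0)
    (ha : theta1 a τ ≠ 0) (hb : theta1 b τ ≠ 0) (hab : theta1 (a + b) τ ≠ 0) :
    sigma (ξ + η) (a + b) τ * (sigma μ a τ * sigma μ (-a) τ - sigma μ b τ * sigma μ (-b) τ)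
      = sigma η b τ * sigma (ξ + η) a τ * sigma ξ b τ
        - sigma ξ a τ * sigma (ξ + η) b τ * sigma η a τ := by
  have W : theta1 (b - η) τ * theta1 a τ * (theta1 (a - (ξ + η)) τ * theta1 (b - ξ) τ)
      + theta1 (a + b - (ξ + η)) τ * theta1 ξ τ * (theta1 (-η) τ * theta1 (a - b) τ)
      + theta1 (a - η) τ * theta1 b τ * (theta1 (b - (ξ + η)) τ * theta1 (-(a - ξ)) τ) = 0 := by
    -- These arguments solve x + y = b - η, x - y = a, z + w = a - ξ - η, z - w = b - ξ.
    convert theta1_three_term hτ ((a + b - η) / 2) ((b - a - η) / 2) ((a + b - 2 * ξ - η) / 2)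
      ((a - b - η) / 2) using 6 <;> ring
  rw [sigma_mul_sigma_neg_sub hτ hμ ha hb]
  simp only [theta1_neg] at W
  simp only [sigma_eq]
  generalize deriv (fun x => theta1 x τ) 0 = t
  field_simp
  linear_combination t ^ 3 * W

/-! ### Explicit form of the operators -/

/-- The argument of the coefficients of the operator `R_k(ξ)` acting on the variables `i`, `j`. -/
def rkArg (μ κ ξ : ℂ) {n : ℕ} (i j : Fin n) (z : Fin n → ℂ) : ℂ := z i - z j + (ξ + μ) / κ

/-- The opposite translations of the variables `i` and `j` by `μ / κ`. -/
def rkShift (μ κ : ℂ) {n : ℕ} (i j : Fin n) (z : Fin n → ℂ) : Fin n → ℂ :=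
  Function.update (Function.update z i (z i + μ / κ)) j (z j - μ / κ)

/-- The exchange of the variables `i` and `j` combined with opposite translations by `ξ / κ`. -/
def rkSwap (ξ κ : ℂ) {n : ℕ} (i j : Fin n) (z : Fin n → ℂ) : Fin n → ℂ :=
  Function.update (Function.update z i (z j - ξ / κ)) j (z i + ξ / κ)

/-- The value of the operator `R_k(ξ)` acting on the variables `i`, `j` outside of the apparent
singularities. -/
def rkVal (τ μ κ ξ : ℂ) {n : ℕ} (i j : Fin n) (f : Fun n) (z : Fin n → ℂ) : ℂ :=
  sigma μ (rkArg μ κ ξ i j z) τ * f (rkShift μ κ i j z)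
    - sigma ξ (rkArg μ κ ξ i j z) τ * f (rkSwap ξ κ i j z)

lemma tensorOp_transl_symm (κ a b : ℂ) (g : Fun 2) (z : Fin 2 → ℂ) :
    tensorOp (transl κ a).symm (transl κ b).symm g z = g ![z 0 + a / κ, z 1 + b / κ] := by
  change g _ = g _
  congr 1
  ext l
  fin_cases l <;> simp

lemma tensorOp_transl (κ a b : ℂ) (g : Fun 2) (z : Fin 2 → ℂ) :
    tensorOp (transl κ a) (transl κ b) g z = g ![z 0 - a / κ, z 1 - b / κ] := by
  change g _ = g _
  congr 1
  ext l
  fin_cases l <;> simp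

/-- The outer translations combine with the inner ones so that ξ₁ and ξ₂ survive only through their
difference, in the unswapped as well as in the swapped term. -/
lemma rExpr_tensorOp_transl (τ μ κ ξ₁ ξ₂ : ℂ) (f : Fun 2) (x y : ℂ) :
    rExpr τ μ (ξ₁ - ξ₂) (tensorOp (transl κ ξ₁) (transl κ (ξ₂ + μ)) f)
      (x + (ξ₁ + μ) / κ) (y + ξ₂ / κ) = rkVal τ μ κ (ξ₁ - ξ₂) 0 1 f ![x, y] := by
  rw [rExpr, tensorOp_transl, tensorOp_transl, rkVal]
  have e : x + (ξ₁ + μ) / κ - (y + ξ₂ / κ) = rkArg μ κ (ξ₁ - ξ₂) 0 1 ![x, y] := by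
    simp only [rkArg, Matrix.cons_val_zero, Matrix.cons_val_one]
    ring
  rw [e]
  congr 3
  · ext l
    fin_cases l <;> simp [rkShift] <;> ring
  · ext l
    fin_cases l <;> simp [rkSwap] <;> ring

lemma map_add_const_punctured_nhds (c x₀ : ℂ) :
    Filter.map (fun x => x + c) (𝓝[≠] x₀) = 𝓝[≠] (x₀ + c) :=
  (Homeomorph.addRight c).map_punctured_nhds_eq x₀

lemma limUnder_add_const (c x₀ : ℂ) (g : ℂ → ℂ) :
    limUnder (𝓝[≠] (x₀ + c)) g = limUnder (𝓝[≠] x₀) (fun x => g (x + c)) := by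
  rw [limUnder, limUnder, ← map_add_const_punctured_nhds, Filter.map_map]
  rfl

open Classical in
lemma conjR_apply (τ μ κ ξ₁ ξ₂ : ℂ) (f : Fun 2) (z : Fin 2 → ℂ) :
    conjR τ μ κ ξ₁ ξ₂ f z =
      if rkArg μ κ (ξ₁ - ξ₂) 0 1 z ∈ lattice τ then
        limUnder (𝓝[≠] (z 0)) (fun x => rkVal τ μ κ (ξ₁ - ξ₂) 0 1 f ![x, z 1])
      else rkVal τ μ κ (ξ₁ - ξ₂) 0 1 f z := by
  rw [conjR, tensorOp_transl_symm, rOp]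
  simp only [Matrix.cons_val_zero, Matrix.cons_val_one]
  have e : z 0 + (ξ₁ + μ) / κ - (z 1 + ξ₂ / κ) = rkArg μ κ (ξ₁ - ξ₂) 0 1 z := by
    simp only [rkArg]
    ring
  have hz : ![z 0, z 1] = z := by ext l; fin_cases l <;> rfl
  rw [limUnder_add_const]
  simp only [e, rExpr_tensorOp_transl, hz]

lemma conjR_eq_Rk (τ μ κ ξ₁ ξ₂ : ℂ) : conjR τ μ κ ξ₁ ξ₂ = Rk τ μ κ (ξ₁ - ξ₂) := by
  funext f z
  rw [Rk, conjR_apply, conjR_apply, sub_zero]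

open Classical in
lemma onPair_Rk_apply (τ μ κ ξ : ℂ) {n : ℕ} {i j : Fin n} (hij : i ≠ j) (f : Fun n)
    (z : Fin n → ℂ) :
    onPair i j (Rk τ μ κ ξ) f z =
      if rkArg μ κ ξ i j z ∈ lattice τ then
        limUnder (𝓝[≠] (z i)) (fun x => rkVal τ μ κ ξ i j f (Function.update z i x))
      else rkVal τ μ κ ξ i j f z := by
  have key : ∀ x, rkVal τ μ κ ξ 0 1
      (fun w => f (Function.update (Function.update z i (w 0)) j (w 1))) ![x, z j]
      = rkVal τ μ κ ξ i j f (Function.update z i x) := by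
    intro x
    simp [rkVal, rkArg, rkShift, rkSwap, hij.symm]
  have h2 : rkArg μ κ ξ 0 1 ![z i, z j] = rkArg μ κ ξ i j z := by simp [rkArg]
  rw [onPair, Rk, conjR_apply, sub_zero]
  simp only [Matrix.cons_val_zero, Matrix.cons_val_one, key, h2]
  rw [Function.update_eq_self]

lemma onPair_Rk_of_notMem (τ μ κ ξ : ℂ) {n : ℕ} {i j : Fin n} (hij : i ≠ j) (f : Fun n)
    (z : Fin n → ℂ) (h : rkArg μ κ ξ i j z ∉ lattice τ) :
    onPair i j (Rk τ μ κ ξ) f z = rkVal τ μ κ ξ i j f z := by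
  classical
  rw [onPair_Rk_apply _ _ _ _ hij, if_neg h]

lemma onPair_zero_one (B : Fun 2 → Fun 2) : onPair 0 1 B = B := by
  funext f z
  have hz : ∀ z : Fin 2 → ℂ, ![z 0, z 1] = z := fun z => by ext l; fin_cases l <;> rfl
  have hw : ∀ w : Fin 2 → ℂ, Function.update (Function.update z 0 (w 0)) 1 (w 1) = w := fun w => by
    ext l; fin_cases l <;> simp
  simp only [onPair, hz, hw]

/-- Disposes of the degenerate case: every coefficient carries the factor ϑ₁'(0). -/
lemma onPair_Rk_eq_zero (τ μ κ ξ : ℂ) {n : ℕ} {i j : Fin n} (hij : i ≠ j)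
    (ht : deriv (fun x => theta1 x τ) 0 = 0) (f : Fun n) : onPair i j (Rk τ μ κ ξ) f = 0 := by
  classical
  have h : ∀ z, rkVal τ μ κ ξ i j f z = 0 := fun z => by simp [rkVal, sigma, ht]
  funext z
  rw [onPair_Rk_apply _ _ _ _ hij]
  simp only [h, Pi.zero_apply, ite_eq_right_iff]
  exact fun _ => tendsto_const_nhds.limUnder_eq

/-! ### The numerator -/

/-- The product of `rkVal` and the common denominator `ϑ₁ (rkArg μ κ ξ i j z)`. -/
def rkNum (τ μ κ ξ : ℂ) {n : ℕ} (i j : Fin n) (f : Fun n) (z : Fin n → ℂ) : ℂ :=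
  theta1 (rkArg μ κ ξ i j z - μ) τ * (deriv (fun x => theta1 x τ) 0 / theta1 (-μ) τ)
      * f (rkShift μ κ i j z)
    - theta1 (rkArg μ κ ξ i j z - ξ) τ * (deriv (fun x => theta1 x τ) 0 / theta1 (-ξ) τ)
      * f (rkSwap ξ κ i j z)

lemma rkNum_eq_mul {τ μ κ ξ : ℂ} {n : ℕ} (i j : Fin n) (f : Fun n) (z : Fin n → ℂ)
    (h : theta1 (rkArg μ κ ξ i j z) τ ≠ 0) :
    rkNum τ μ κ ξ i j f z = theta1 (rkArg μ κ ξ i j z) τ * rkVal τ μ κ ξ i j f z := by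
  rw [rkNum, rkVal, sigma, sigma]
  field_simp

lemma differentiable_rkShift (μ κ : ℂ) {n : ℕ} (i j : Fin n) :
    Differentiable ℂ (rkShift μ κ i j) := by
  rw [differentiable_pi]
  intro l
  simp only [rkShift, Function.update_apply]
  split_ifs <;> fun_prop

lemma differentiable_rkSwap (ξ κ : ℂ) {n : ℕ} (i j : Fin n) :
    Differentiable ℂ (rkSwap ξ κ i j) := by
  rw [differentiable_pi]
  intro l
  simp only [rkSwap, Function.update_apply]
  split_ifs <;> fun_prop

lemma differentiable_rkNum {τ : ℂ} (hτ : 0 < τ.im) (μ κ ξ : ℂ) {n : ℕ} (i j : Fin n) {f : Fun n}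
    (hf : Differentiable ℂ f) : Differentiable ℂ (rkNum τ μ κ ξ i j f) := by
  have h1 : ∀ w, Differentiable ℂ fun z : Fin n → ℂ => theta1 (rkArg μ κ ξ i j z - w) τ := by
    intro w
    have : Differentiable ℂ fun z : Fin n → ℂ => rkArg μ κ ξ i j z - w := by
      simp only [rkArg]
      fun_prop
    exact (differentiable_theta1 hτ).comp this
  exact (((h1 μ).mul_const _).mul (hf.comp (differentiable_rkShift μ κ i j))).sub
    (((h1 ξ).mul_const _).mul (hf.comp (differentiable_rkSwap ξ κ i j)))

/-- Under the translation of one variable by a quasi-period, the numerator is multiplied by the product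
of the multipliers of the denominator and of the given function. -/
lemma rkNum_quasiperiodic {τ μ κ ξ ω : ℂ} {n : ℕ} {i j : Fin n} (hij : i ≠ j) {f : Fun n}
    {p m a : ℂ → ℂ} (hp0 : ∀ u, p u ≠ 0) (hm0 : ∀ u, m u ≠ 0)
    (hp : ∀ u, theta1 (u + ω) τ = p u * theta1 u τ)
    (hm : ∀ u, theta1 (u - ω) τ = m u * theta1 u τ)
    (hpa : ∀ w u x, p (u - w) * a (x + w / κ) = p u * a x)
    (hma : ∀ w u x, m (u - w) * a (x - w / κ) = m u * a x)
    (hf : ∀ (l : Fin n) z, f (Function.update z l (z l + ω)) = a (z l) * f z)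
    (l : Fin n) (z : Fin n → ℂ) :
    ∃ c, c ≠ 0 ∧
      theta1 (rkArg μ κ ξ i j (Function.update z l (z l + ω))) τ
        = c * theta1 (rkArg μ κ ξ i j z) τ ∧
      rkNum τ μ κ ξ i j f (Function.update z l (z l + ω))
        = c * a (z l) * rkNum τ μ κ ξ i j f z := by
  -- The theta argument moves by ω, by -ω or not at all, according to whether `l` is `i`, `j` or
  -- neither. `hpa` and `hma` say that offsetting the theta argument by w and the argument of `f` by
  -- w/κ has no net effect, so the two terms of the numerator acquire the same multiplier.
  rcases eq_or_ne l i with rfl | hli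
  · have hD : rkArg μ κ ξ l j (Function.update z l (z l + ω)) = rkArg μ κ ξ l j z + ω := by
      simp only [rkArg, Function.update_self, Function.update_of_ne hij.symm]
      ring
    have h1 : f (rkShift μ κ l j (Function.update z l (z l + ω)))
        = a (z l + μ / κ) * f (rkShift μ κ l j z) := by
      have := hf l (rkShift μ κ l j z)
      rw [show rkShift μ κ l j z l = z l + μ / κ by simp [rkShift, hij]] at this
      rw [← this]
      congr 1
      ext r
      simp only [rkShift, Function.update_apply]
      split_ifs <;> simp_all
      ring
    have h2 : f (rkSwap ξ κ l j (Function.update z l (z l + ω)))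
        = a (z l + ξ / κ) * f (rkSwap ξ κ l j z) := by
      -- After the exchange, the moving variable `z l` occupies slot `j` of `f`.
      have := hf j (rkSwap ξ κ l j z)
      rw [show rkSwap ξ κ l j z j = z l + ξ / κ by simp [rkSwap]] at this
      rw [← this]
      congr 1
      ext r
      simp only [rkSwap, Function.update_apply]
      split_ifs <;> simp_all
      ring
    refine ⟨p (rkArg μ κ ξ l j z), hp0 _, by rw [hD, hp], ?_⟩
    rw [rkNum, rkNum, h1, h2, hD, add_sub_right_comm, add_sub_right_comm, hp, hp]
    linear_combination (theta1 (rkArg μ κ ξ l j z - μ) τ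
        * (deriv (fun x => theta1 x τ) 0 / theta1 (-μ) τ) * f (rkShift μ κ l j z))
        * hpa μ (rkArg μ κ ξ l j z) (z l)
      - (theta1 (rkArg μ κ ξ l j z - ξ) τ
        * (deriv (fun x => theta1 x τ) 0 / theta1 (-ξ) τ) * f (rkSwap ξ κ l j z))
        * hpa ξ (rkArg μ κ ξ l j z) (z l)
  rcases eq_or_ne l j with rfl | hlj
  · have hD : rkArg μ κ ξ i l (Function.update z l (z l + ω)) = rkArg μ κ ξ i l z - ω := by
      simp only [rkArg, Function.update_self, Function.update_of_ne hij]
      ring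
    have h1 : f (rkShift μ κ i l (Function.update z l (z l + ω)))
        = a (z l - μ / κ) * f (rkShift μ κ i l z) := by
      have := hf l (rkShift μ κ i l z)
      rw [show rkShift μ κ i l z l = z l - μ / κ by simp [rkShift]] at this
      rw [← this]
      congr 1
      ext r
      simp only [rkShift, Function.update_apply]
      split_ifs <;> simp_all
      ring
    have h2 : f (rkSwap ξ κ i l (Function.update z l (z l + ω)))
        = a (z l - ξ / κ) * f (rkSwap ξ κ i l z) := by
      have := hf i (rkSwap ξ κ i l z)
      rw [show rkSwap ξ κ i l z i = z l - ξ / κ by simp [rkSwap, hij]] at this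
      rw [← this]
      congr 1
      ext r
      simp only [rkSwap, Function.update_apply]
      split_ifs <;> simp_all
      ring
    refine ⟨m (rkArg μ κ ξ i l z), hm0 _, by rw [hD, hm], ?_⟩
    rw [rkNum, rkNum, h1, h2, hD, sub_right_comm, sub_right_comm _ ω, hm, hm]
    linear_combination (theta1 (rkArg μ κ ξ i l z - μ) τ
        * (deriv (fun x => theta1 x τ) 0 / theta1 (-μ) τ) * f (rkShift μ κ i l z))
        * hma μ (rkArg μ κ ξ i l z) (z l)
      - (theta1 (rkArg μ κ ξ i l z - ξ) τ
        * (deriv (fun x => theta1 x τ) 0 / theta1 (-ξ) τ) * f (rkSwap ξ κ i l z))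
        * hma ξ (rkArg μ κ ξ i l z) (z l)
  · have hD : rkArg μ κ ξ i j (Function.update z l (z l + ω)) = rkArg μ κ ξ i j z := by
      simp only [rkArg, Function.update_of_ne hli.symm, Function.update_of_ne hlj.symm]
    have h1 : f (rkShift μ κ i j (Function.update z l (z l + ω)))
        = a (z l) * f (rkShift μ κ i j z) := by
      have := hf l (rkShift μ κ i j z)
      rw [show rkShift μ κ i j z l = z l by simp [rkShift, hli, hlj]] at this
      rw [← this]
      congr 1
      ext r
      simp only [rkShift, Function.update_apply]
      split_ifs <;> simp_all
    have h2 : f (rkSwap ξ κ i j (Function.update z l (z l + ω)))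
        = a (z l) * f (rkSwap ξ κ i j z) := by
      have := hf l (rkSwap ξ κ i j z)
      rw [show rkSwap ξ κ i j z l = z l by simp [rkSwap, hli, hlj]] at this
      rw [← this]
      congr 1
      ext r
      simp only [rkSwap, Function.update_apply]
      split_ifs <;> simp_all
    refine ⟨1, one_ne_zero, by rw [hD, one_mul], ?_⟩
    rw [rkNum, rkNum, h1, h2, hD]
    ring

lemma mem_tensorV_zero_iff {τ : ℂ} {k n : ℕ} {f : Fun n} :
    f ∈ tensorV τ k (fun _ : Fin n => 0) ↔ Differentiable ℂ f ∧
      (∀ (l : Fin n) z, f (Function.update z l (z l + 1)) = f z) ∧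
      ∀ (l : Fin n) z, f (Function.update z l (z l + τ)) = alpha τ k (z l) 0 * f z := by
  constructor
  · rintro ⟨h1, h2⟩
    refine ⟨h1, fun l z => ?_, fun l z => ?_⟩
    · simpa using (h2 l z).2.1 (z l)
    · simpa using (h2 l z).2.2 (z l)
  · rintro ⟨h1, h2, h3⟩
    refine ⟨h1, fun l z => ⟨?_, fun x => ?_, fun x => ?_⟩⟩
    · refine h1.comp ?_
      rw [differentiable_pi]
      intro r
      simp only [Function.update_apply]
      split_ifs <;> fun_prop
    · simpa using h2 l (Function.update z l x)
    · simpa using h3 l (Function.update z l x)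

lemma theta1_sub_one (z τ : ℂ) : theta1 (z - 1) τ = -theta1 z τ := by
  have := theta1_add_one (z - 1) τ
  rw [sub_add_cancel] at this
  rw [this, neg_neg]

lemma theta1_sub_tau (z τ : ℂ) :
    theta1 (z - τ) τ = -exp (-(Real.pi * I * τ) + 2 * Real.pi * I * z) * theta1 z τ := by
  have := theta1_add_tau (-z) τ
  rw [show -z + τ = -(z - τ) by ring, theta1_neg, theta1_neg] at this
  rw [show (-(Real.pi * I * τ) - 2 * Real.pi * I * -z : ℂ)
    = -(Real.pi * I * τ) + 2 * Real.pi * I * z by ring] at this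
  linear_combination -this

lemma rkNum_add_one {τ μ κ ξ : ℂ} {n : ℕ} {i j : Fin n} (hij : i ≠ j) {f : Fun n}
    (hf : ∀ (l : Fin n) z, f (Function.update z l (z l + 1)) = f z) (l : Fin n) (z : Fin n → ℂ) :
    ∃ c, c ≠ 0 ∧
      theta1 (rkArg μ κ ξ i j (Function.update z l (z l + 1))) τ
        = c * theta1 (rkArg μ κ ξ i j z) τ ∧
      rkNum τ μ κ ξ i j f (Function.update z l (z l + 1)) = c * 1 * rkNum τ μ κ ξ i j f z :=
  rkNum_quasiperiodic hij (p := fun _ => -1) (m := fun _ => -1) (a := fun _ => 1)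
    (by simp) (by simp) (by simp [theta1_add_one]) (by simp [theta1_sub_one]) (by simp) (by simp)
    (by simpa using hf) l z

/-- The degree k in the exponent of `alpha` turns a translation by w/k into a factor exp(-2πiw),
which cancels the one produced by the offset w in the multiplier of ϑ₁. -/
lemma rkNum_add_tau {τ μ ξ : ℂ} {k n : ℕ} (hk : 0 < k) {i j : Fin n} (hij : i ≠ j) {f : Fun n}
    (hf : ∀ (l : Fin n) z, f (Function.update z l (z l + τ)) = alpha τ k (z l) 0 * f z)
    (l : Fin n) (z : Fin n → ℂ) :
    ∃ c, c ≠ 0 ∧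
      theta1 (rkArg μ k ξ i j (Function.update z l (z l + τ))) τ
        = c * theta1 (rkArg μ k ξ i j z) τ ∧
      rkNum τ μ k ξ i j f (Function.update z l (z l + τ))
        = c * alpha τ k (z l) 0 * rkNum τ μ k ξ i j f z := by
  have hk' : (k : ℂ) ≠ 0 := by exact_mod_cast hk.ne'
  refine rkNum_quasiperiodic hij
    (p := fun u => -exp (-(Real.pi * I * τ) - 2 * Real.pi * I * u))
    (m := fun u => -exp (-(Real.pi * I * τ) + 2 * Real.pi * I * u)) (a := fun x => alpha τ k x 0)
    (by simp [Complex.exp_ne_zero]) (by simp [Complex.exp_ne_zero])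
    (fun u => theta1_add_tau u τ) (fun u => theta1_sub_tau u τ) ?_ ?_ hf l z
  · intro w u x
    rw [alpha, alpha, neg_mul (exp _), neg_mul (exp _), ← exp_add, ← exp_add]
    congr 2
    field_simp
    ring
  · intro w u x
    rw [alpha, alpha, neg_mul (exp _), neg_mul (exp _), ← exp_add, ← exp_add]
    congr 2
    field_simp
    ring

lemma rkNum_eq_zero {τ μ ξ : ℂ} {k n : ℕ} (hk : 0 < k) {i j : Fin n} (hij : i ≠ j)
    (hμ : theta1 μ τ ≠ 0) (hξ : theta1 ξ τ ≠ 0) {f : Fun n}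
    (hf : f ∈ tensorV τ k (fun _ : Fin n => 0)) (z : Fin n → ℂ)
    (hz : rkArg μ k ξ i j z ∈ lattice τ) : rkNum τ μ k ξ i j f z = 0 := by
  obtain ⟨-, hf1, hf2⟩ := mem_tensorV_zero_iff.1 hf
  have hD : ∀ z ω, rkArg μ k ξ i j (Function.update z i (z i + ω)) = rkArg μ k ξ i j z + ω := by
    intro z ω
    simp only [rkArg, Function.update_self, Function.update_of_ne hij.symm]
    ring
  have step : ∀ (ω : ℂ) (a : ℂ → ℂ), (∀ u, a u ≠ 0) →
      (∀ z, ∃ c, c ≠ 0 ∧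
      theta1 (rkArg μ k ξ i j (Function.update z i (z i + ω))) τ
        = c * theta1 (rkArg μ k ξ i j z) τ ∧
      rkNum τ μ k ξ i j f (Function.update z i (z i + ω))
        = c * a (z i) * rkNum τ μ k ξ i j f z) →
      ∀ w, (∀ z, rkArg μ k ξ i j z = w + ω → rkNum τ μ k ξ i j f z = 0) ↔
        (∀ z, rkArg μ k ξ i j z = w → rkNum τ μ k ξ i j f z = 0) := by
    intro ω a ha h w
    constructor
    · intro H z hz
      obtain ⟨c, hc, -, h3⟩ := h z
      rw [H _ (by rw [hD, hz])] at h3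
      simpa [hc, ha] using h3.symm
    · intro H z hz
      have e : Function.update (Function.update z i (z i - ω)) i
          (Function.update z i (z i - ω) i + ω) = z := by simp
      obtain ⟨c, hc, -, h3⟩ := h (Function.update z i (z i - ω))
      have := hD (Function.update z i (z i - ω)) ω
      rw [e] at h3 this
      rw [h3, H _ (by rw [hz] at this; exact (add_right_cancel this).symm), mul_zero]
  refine lattice_induction
    (p := fun w => ∀ z, rkArg μ k ξ i j z = w → rkNum τ μ k ξ i j f z = 0) ?_
    (step 1 (fun _ => 1) (by simp) fun z => rkNum_add_one hij hf1 i z)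
    (step τ (fun u => alpha τ k u 0) (by simp [alpha, Complex.exp_ne_zero])
      fun z => rkNum_add_tau hk hij hf2 i z) hz z rfl
  intro z hz
  -- At argument 0 both terms evaluate `f` at the same point, each with coefficient ϑ₁'(0).
  have hS : rkShift μ k i j z = rkSwap ξ k i j z := by
    rw [rkArg] at hz
    rw [rkShift, rkSwap, show z i + μ / k = z j - ξ / k by linear_combination hz,
      show z j - μ / k = z i + ξ / k by linear_combination -hz]
  rw [rkNum, hz, hS, zero_sub, zero_sub, mul_div_cancel₀, mul_div_cancel₀, sub_self]
  · rwa [theta1_neg, neg_ne_zero]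
  · rwa [theta1_neg, neg_ne_zero]

/-! ### Preservation of the spaces of theta functions -/

/-- The numerator of `R_k(ξ) f` is divisible by the denominator. -/
lemma exists_rkNum_eq_mul {τ μ ξ : ℂ} (hτ : 0 < τ.im) {k n : ℕ} (hk : 0 < k) {i j : Fin n}
    (hij : i ≠ j) (hμ : μ ∉ lattice τ) (hξ : ξ ∉ lattice τ)
    (ht : deriv (fun x => theta1 x τ) 0 ≠ 0) {f : Fun n}
    (hf : f ∈ tensorV τ k (fun _ : Fin n => 0)) :
    ∃ H : Fun n, Differentiable ℂ H ∧
      ∀ z, rkNum τ μ k ξ i j f z = theta1 (rkArg μ k ξ i j z) τ * H z := by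
  obtain ⟨hzero, hsimple⟩ := theta1_simple_zeros hτ ht
  set ℓ : (Fin n → ℂ) →L[ℂ] ℂ := ContinuousLinearMap.proj (R := ℂ) (φ := fun _ : Fin n => ℂ) i
    - ContinuousLinearMap.proj (R := ℂ) (φ := fun _ : Fin n => ℂ) j with hℓ
  have hD : ∀ z, rkArg μ k ξ i j z = ℓ z + (ξ + μ) / k := fun z => by simp [rkArg, hℓ]
  have hv : ℓ (Pi.single i 1) = 1 := by simp [hℓ, hij.symm]
  simp only [hD]
  refine exists_differentiable_mul_eq (φ := fun x => theta1 x τ) (differentiable_theta1 hτ) hsimple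
    ℓ ((ξ + μ) / k) hv (differentiable_rkNum hτ μ k ξ i j (mem_tensorV_zero_iff.1 hf).1) ?_
  intro z hz
  refine rkNum_eq_zero hk hij (fun h => hμ ((hzero _).1 h)) (fun h => hξ ((hzero _).1 h)) hf z ?_
  rw [hD]
  exact (hzero _).1 hz

/-- The operators `R_k(ξ)` preserve the tensor powers of the space of theta functions. -/
lemma onPair_Rk_mem_tensorV {τ μ ξ : ℂ} (hτ : 0 < τ.im) {k n : ℕ} (hk : 0 < k) {i j : Fin n}
    (hij : i ≠ j) (hμ : μ ∉ lattice τ) (hξ : ξ ∉ lattice τ) {f : Fun n}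
    (hf : f ∈ tensorV τ k (fun _ : Fin n => 0)) :
    onPair i j (Rk τ μ k ξ) f ∈ tensorV τ k (fun _ : Fin n => 0) := by
  by_cases ht : deriv (fun x => theta1 x τ) 0 = 0
  · rw [onPair_Rk_eq_zero _ _ _ _ hij ht]
    exact Submodule.zero_mem _
  obtain ⟨hzero, -⟩ := theta1_simple_zeros hτ ht
  obtain ⟨-, hf1, hf2⟩ := mem_tensorV_zero_iff.1 hf
  obtain ⟨H, hH, hmul⟩ := exists_rkNum_eq_mul hτ hk hij hμ hξ ht hf
  have hline : ∀ z (s : ℂ), rkArg μ k ξ i j (z + s • Pi.single i 1)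
      = rkArg μ k ξ i j z + s * 1 := by
    intro z s
    simp only [rkArg, Pi.add_apply, Pi.smul_apply, Pi.single_eq_same, Pi.single_eq_of_ne hij.symm,
      smul_eq_mul]
    ring
  have hval : ∀ z, rkArg μ k ξ i j z ∉ lattice τ → rkVal τ μ k ξ i j f z = H z := by
    intro z hz
    have h0 : theta1 (rkArg μ k ξ i j z) τ ≠ 0 := fun h => hz ((hzero _).1 h)
    exact mul_left_cancel₀ h0 (by rw [← hmul, rkNum_eq_mul _ _ _ _ h0])
  have hupd : ∀ (z : Fin n → ℂ) (s : ℂ),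
      z + s • Pi.single i 1 = Function.update z i (z i + s) := by
    intro z s
    ext r
    rcases eq_or_ne r i with rfl | hr
    · simp
    · simp [hr]
  -- Off the singular set the values agree by cancellation of ϑ₁; on it, the limit in the definition
  -- of the operator is the value of the continuous function `H`.
  have hext : onPair i j (Rk τ μ k ξ) f = H := by
    classical
    funext z
    rw [onPair_Rk_apply _ _ _ _ hij]
    split_ifs with hz
    · refine Tendsto.limUnder_eq ?_
      have h1 : Tendsto (fun x => H (Function.update z i x)) (𝓝[≠] (z i)) (𝓝 (H z)) := by
        have : Continuous fun x => H (Function.update z i x) :=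
          hH.continuous.comp (by fun_prop)
        have h2 := this.tendsto (z i)
        rw [Function.update_eq_self] at h2
        exact h2.mono_left nhdsWithin_le_nhds
      refine h1.congr' ?_
      rw [← zero_add (z i), ← map_add_const_punctured_nhds]
      refine Filter.eventually_map.2 ?_
      filter_upwards [eventually_notMem_lattice hτ (rkArg μ k ξ i j z) one_ne_zero] with s hs
      refine (hval _ ?_).symm
      rwa [← hline, hupd, add_comm (z i)] at hs
    · exact hval z hz
  -- The factor `c` is common to numerator and denominator, so only the multiplier `a` of `f`
  -- remains for the quotient.
  have hquasi : ∀ (ω : ℂ) (a : ℂ → ℂ) (l : Fin n), Continuous a →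
      (∀ z, ∃ c, c ≠ 0 ∧
      theta1 (rkArg μ k ξ i j (Function.update z l (z l + ω))) τ
        = c * theta1 (rkArg μ k ξ i j z) τ ∧
      rkNum τ μ k ξ i j f (Function.update z l (z l + ω))
        = c * a (z l) * rkNum τ μ k ξ i j f z) →
      ∀ z, H (Function.update z l (z l + ω)) = a (z l) * H z := by
    intro ω a l ha h z
    refine eq_of_eventually_line (A := fun z => H (Function.update z l (z l + ω)))
      (B := fun z => a (z l) * H z) (hH.continuous.comp (by fun_prop))
      ((ha.comp (continuous_apply l)).mul hH.continuous) (Pi.single i 1) z ?_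
    filter_upwards [eventually_notMem_lattice hτ (rkArg μ k ξ i j z) one_ne_zero] with s hs
    rw [← hline] at hs
    obtain ⟨c, hc, h2, h3⟩ := h (z + s • Pi.single i 1)
    rw [hmul, hmul, h2] at h3
    have h4 : c * theta1 (rkArg μ k ξ i j (z + s • Pi.single i 1)) τ ≠ 0 :=
      mul_ne_zero hc fun h => hs ((hzero _).1 h)
    exact mul_left_cancel₀ h4 (by linear_combination h3)
  rw [hext, mem_tensorV_zero_iff]
  refine ⟨hH, fun l z => ?_, fun l => ?_⟩
  · simpa using hquasi 1 (fun _ => 1) l continuous_const (fun z => rkNum_add_one hij hf1 l z) z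
  · refine hquasi τ (fun u => alpha τ k u 0) l ?_ fun z => rkNum_add_tau hk hij hf2 l z
    simp only [alpha]
    fun_prop

/-! ### The quantum Yang-Baxter equation -/

section ThreeVariables

variable {τ μ κ ξ M X D : ℂ}

/-- The argument of the coefficients is passed as a free name `D`, so that nested expansions involve
only a few common atoms. -/
lemma onPair_zero_one_Rk (hM : μ / κ = M) (hX : ξ / κ = X) (f : Fun 3) (x y w : ℂ)
    (hD : x - y + X + M = D) (h : D ∉ lattice τ) :
    onPair 0 1 (Rk τ μ κ ξ) f ![x, y, w]
      = sigma μ D τ * f ![x + M, y - M, w] - sigma ξ D τ * f ![y - X, x + X, w] := by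
  have hD' : rkArg μ κ ξ 0 1 ![x, y, w] = D := by
    rw [← hD, ← hM, ← hX]
    simp [rkArg]
    ring
  rw [onPair_Rk_of_notMem _ _ _ _ (by decide) _ _ (by rwa [hD']), rkVal, hD']
  congr 3
  · ext l
    fin_cases l <;> simp [rkShift, hM]
  · ext l
    fin_cases l <;> simp [rkSwap, hX]

lemma onPair_zero_two_Rk (hM : μ / κ = M) (hX : ξ / κ = X) (f : Fun 3) (x y w : ℂ)
    (hD : x - w + X + M = D) (h : D ∉ lattice τ) :
    onPair 0 2 (Rk τ μ κ ξ) f ![x, y, w]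
      = sigma μ D τ * f ![x + M, y, w - M] - sigma ξ D τ * f ![w - X, y, x + X] := by
  have hD' : rkArg μ κ ξ 0 2 ![x, y, w] = D := by
    rw [← hD, ← hM, ← hX]
    simp [rkArg]
    ring
  rw [onPair_Rk_of_notMem _ _ _ _ (by decide) _ _ (by rwa [hD']), rkVal, hD']
  congr 3
  · ext l
    fin_cases l <;> simp [rkShift, hM]
  · ext l
    fin_cases l <;> simp [rkSwap, hX]

lemma onPair_one_two_Rk (hM : μ / κ = M) (hX : ξ / κ = X) (f : Fun 3) (x y w : ℂ)
    (hD : y - w + X + M = D) (h : D ∉ lattice τ) :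
    onPair 1 2 (Rk τ μ κ ξ) f ![x, y, w]
      = sigma μ D τ * f ![x, y + M, w - M] - sigma ξ D τ * f ![x, w - X, y + X] := by
  have hD' : rkArg μ κ ξ 1 2 ![x, y, w] = D := by
    rw [← hD, ← hM, ← hX]
    simp [rkArg]
    ring
  rw [onPair_Rk_of_notMem _ _ _ _ (by decide) _ _ (by rwa [hD']), rkVal, hD']
  congr 3
  · ext l
    fin_cases l <;> simp [rkShift, hM]
  · ext l
    fin_cases l <;> simp [rkSwap, hX]

end ThreeVariables

/-- The quantum Yang-Baxter equation for arbitrary functions, outside of the poles of the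
coefficients. -/
lemma yang_baxter_of_notMem {τ μ κ ξ η : ℂ} (hτ : 0 < τ.im) (hμ : μ ∉ lattice τ)
    (hξ : ξ ∉ lattice τ) (hη : η ∉ lattice τ) (hξη : ξ + η ∉ lattice τ) (f : Fun 3) (x y w : ℂ)
    (h1 : x - y + (ξ + μ) / κ ∉ lattice τ) (h2 : y - w + (η + μ) / κ ∉ lattice τ)
    (h3 : x - w + (ξ + η + 2 * μ) / κ ∉ lattice τ) :
    onPair 0 1 (Rk τ μ κ ξ) (onPair 0 2 (Rk τ μ κ (ξ + η)) (onPair 1 2 (Rk τ μ κ η) f)) ![x, y, w]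
      = onPair 1 2 (Rk τ μ κ η) (onPair 0 2 (Rk τ μ κ (ξ + η)) (onPair 0 1 (Rk τ μ κ ξ) f))
        ![x, y, w] := by
  by_cases ht : deriv (fun x => theta1 x τ) 0 = 0
  · rw [onPair_Rk_eq_zero _ _ _ _ (by decide) ht, onPair_Rk_eq_zero _ _ _ _ (by decide) ht]
  obtain ⟨hzero, -⟩ := theta1_simple_zeros hτ ht
  obtain ⟨M, hM⟩ : ∃ M, μ / κ = M := ⟨_, rfl⟩
  obtain ⟨X, hX⟩ : ∃ X, ξ / κ = X := ⟨_, rfl⟩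
  obtain ⟨Y, hY⟩ : ∃ Y, η / κ = Y := ⟨_, rfl⟩
  have hXY : (ξ + η) / κ = X + Y := by rw [add_div, hX, hY]
  obtain ⟨a, ha⟩ : ∃ a, x - y + X + M = a := ⟨_, rfl⟩
  obtain ⟨b, hb⟩ : ∃ b, y - w + Y + M = b := ⟨_, rfl⟩
  have ha' : a ∉ lattice τ := by
    rw [← ha, ← hX, ← hM]
    convert h1 using 2
    ring
  have hb' : b ∉ lattice τ := by
    rw [← hb, ← hY, ← hM]
    convert h2 using 2
    ring
  have hc' : a + b ∉ lattice τ := by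
    rw [← hb, ← ha, ← hY, ← hX, ← hM]
    convert h3 using 2
    ring
  have hna : -a ∉ lattice τ := fun h => ha' (neg_mem_lattice_iff.1 h)
  have hnb : -b ∉ lattice τ := fun h => hb' (neg_mem_lattice_iff.1 h)
  have ne : ∀ {u : ℂ}, u ∉ lattice τ → theta1 u τ ≠ 0 := fun hu h => hu ((hzero _).1 h)
  -- `C1` and `C2` govern the values of `f` with cyclically permuted arguments, `C3` those with `x`
  -- and `w` exchanged.
  have C1 := sigma_mul_sigma hτ (ξ := ξ) (η := η) (u := a + b) (v := b) (ne hξ) (ne hη) (ne hξη)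
    (ne hc') (ne hb') (by rw [add_sub_cancel_right]; exact ne ha')
  have C2 := sigma_mul_sigma hτ (ξ := ξ) (η := η) (u := a) (v := a + b) (ne hξ) (ne hη) (ne hξη)
    (ne ha') (ne hc') (by rw [sub_add_cancel_left]; exact ne hnb)
  have C3 := sigma_four_term hτ (ne hμ) (ne hξ) (ne hη) (ne hξη) (ne ha') (ne hb') (ne hc')
  rw [add_sub_cancel_right, sub_add_cancel_right] at C1
  rw [add_sub_cancel_left, sub_add_cancel_left] at C2
  -- Each side requires seven evaluations. Their arguments are only ±a, ±b and a + b, none of them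
  -- in the lattice, so limit values never occur and `f` may be arbitrary.
  rw [onPair_zero_one_Rk hM hX _ _ _ _ ha ha',
    onPair_zero_two_Rk hM hXY _ (x + M) (y - M) w (D := a + b) (by rw [← ha, ← hb]; ring) hc',
    onPair_zero_two_Rk hM hXY _ (y - X) (x + X) w (D := b) (by rw [← hb]; ring) hb',
    onPair_one_two_Rk hM hY _ (x + M + M) (y - M) (w - M) (D := b) (by rw [← hb]; ring) hb',
    onPair_one_two_Rk hM hY _ (w - (X + Y)) (y - M) (x + M + (X + Y)) (D := -a)
      (by rw [← ha]; ring) hna,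
    onPair_one_two_Rk hM hY _ (y - X + M) (x + X) (w - M) (D := a + b)
      (by rw [← ha, ← hb]; ring) hc',
    onPair_one_two_Rk hM hY _ (w - (X + Y)) (x + X) (y - X + (X + Y)) (D := a)
      (by rw [← ha]; ring) ha',
    onPair_one_two_Rk hM hY _ x y w hb hb',
    onPair_zero_two_Rk hM hXY _ x (y + M) (w - M) (D := a + b) (by rw [← ha, ← hb]; ring) hc',
    onPair_zero_two_Rk hM hXY _ x (w - Y) (y + Y) (D := a) (by rw [← ha]; ring) ha',
    onPair_zero_one_Rk hM hX _ (x + M) (y + M) (w - M - M) (D := a) (by rw [← ha]; ring) ha',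
    onPair_zero_one_Rk hM hX _ (w - M - (X + Y)) (y + M) (x + (X + Y)) (D := -b)
      (by rw [← hb]; ring) hnb,
    onPair_zero_one_Rk hM hX _ (x + M) (w - Y) (y + Y - M) (D := a + b)
      (by rw [← ha, ← hb]; ring) hc',
    onPair_zero_one_Rk hM hX _ (y + Y - (X + Y)) (w - Y) (x + (X + Y)) (D := b)
      (by rw [← hb]; ring) hb']
  obtain ⟨F, hF⟩ : ∃ F : ℂ → ℂ → ℂ → ℂ, ∀ x y w, f ![x, y, w] = F x y w := ⟨_, fun _ _ _ => rfl⟩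
  simp only [hF]
  clear ha hb ha' hb' hc' hna hnb h1 h2 h3 hF
  generalize sigma ξ a τ = xa, sigma ξ b τ = xb, sigma ξ (a + b) τ = xc, sigma ξ (-b) τ = xnb,
    sigma η a τ = ya, sigma η b τ = yb, sigma η (a + b) τ = yc, sigma η (-a) τ = yna,
    sigma (ξ + η) a τ = sa, sigma (ξ + η) b τ = sb, sigma (ξ + η) (a + b) τ = sc,
    sigma μ a τ = ma, sigma μ b τ = mb, sigma μ (a + b) τ = mc, sigma μ (-a) τ = mna,
    sigma μ (-b) τ = mnb at *
  ring_nf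
  -- The terms for the identity and for the exchanges of `x`, `y` and of `y`, `w` agree on both
  -- sides without any relation.
  linear_combination (-ma * F (w - Y - X) (x + M + X) (-M + y + Y)) * C1
    + (mb * F (M + y - X) (-M + w - Y) (x + Y + X)) * C2 - F (w - Y - X) y (x + Y + X) * C3

/-- Entire functions of three variables agree if they agree outside of translates of the lattice in the
differences of the variables. -/
lemma eq_of_eq_notMem_lattice {τ : ℂ} (hτ : 0 < τ.im) {A B : Fun 3} (hA : Continuous A)
    (hB : Continuous B) (c₁ c₂ c₃ : ℂ)
    (h : ∀ z : Fin 3 → ℂ, z 0 - z 1 + c₁ ∉ lattice τ → z 0 - z 2 + c₂ ∉ lattice τ →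
      z 1 - z 2 + c₃ ∉ lattice τ → A z = B z) : A = B := by
  funext z
  -- Along this direction the three differences have slopes 1, 2, 1, all nonzero, so nearby points
  -- of the line avoid all three exceptional sets.
  refine eq_of_eventually_line hA hB ![2, 1, 0] z ?_
  filter_upwards [eventually_notMem_lattice hτ (z 0 - z 1 + c₁) one_ne_zero,
    eventually_notMem_lattice hτ (z 0 - z 2 + c₂) two_ne_zero,
    eventually_notMem_lattice hτ (z 1 - z 2 + c₃) one_ne_zero] with s h1 h2 h3
  refine h _ ?_ ?_ ?_
  · convert h1 using 2
    simp
    ring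
  · convert h2 using 2
    simp
    ring
  · convert h3 using 2
    simp
    ring

/-- The operator `R_k(ξ)` is linear on theta functions. -/
lemma Rk_linear {τ μ ξ : ℂ} (hτ : 0 < τ.im) {k : ℕ} (hk : 0 < k) (hμ : μ ∉ lattice τ)
    (hξ : ξ ∉ lattice τ) {f g : Fun 2} (hf : f ∈ tensorV τ k (fun _ : Fin 2 => 0))
    (hg : g ∈ tensorV τ k (fun _ : Fin 2 => 0)) (a b : ℂ) :
    Rk τ μ k ξ (a • f + b • g) = a • Rk τ μ k ξ f + b • Rk τ μ k ξ g := by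
  have h01 : (0 : Fin 2) ≠ 1 := by decide
  have hmem : ∀ {f : Fun 2}, f ∈ tensorV τ k (fun _ : Fin 2 => 0) →
      Continuous (onPair 0 1 (Rk τ μ k ξ) f) := fun hf =>
    (onPair_Rk_mem_tensorV hτ hk h01 hμ hξ hf).1.continuous
  rw [← onPair_zero_one (Rk τ μ k ξ)]
  funext z
  -- At singular points the operator is a limit, so linearity is checked off them and extended by
  -- continuity of the images.
  refine eq_of_eventually_line
    (hmem (Submodule.add_mem _ (Submodule.smul_mem _ a hf) (Submodule.smul_mem _ b hg)))
    (((hmem hf).const_smul a).add ((hmem hg).const_smul b)) ![1, 0] z ?_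
  filter_upwards [eventually_notMem_lattice hτ (rkArg μ k ξ 0 1 z) one_ne_zero] with s hs
  have hs' : rkArg μ k ξ 0 1 (z + s • ![1, 0]) ∉ lattice τ := by
    convert hs using 2
    simp [rkArg]
    ring
  simp only [Pi.add_apply, Pi.smul_apply, onPair_Rk_of_notMem _ _ _ _ h01 _ _ hs', rkVal, smul_eq_mul]
  ring

lemma yang_baxter_apply {τ μ ξ₁ ξ₂ ξ₃ κ : ℂ} (hτ : 0 < τ.im) (hμ : μ ∉ lattice τ)
    (h12 : ξ₁ - ξ₂ ∉ lattice τ) (h13 : ξ₁ - ξ₃ ∉ lattice τ) (h23 : ξ₂ - ξ₃ ∉ lattice τ) (f : Fun 3)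
    (z : Fin 3 → ℂ) (h1 : z 0 - z 1 + (ξ₁ - ξ₂ + μ) / κ ∉ lattice τ)
    (h2 : z 0 - z 2 + (ξ₁ - ξ₃ + 2 * μ) / κ ∉ lattice τ)
    (h3 : z 1 - z 2 + (ξ₂ - ξ₃ + μ) / κ ∉ lattice τ) :
    onPair 0 1 (Rk τ μ κ (ξ₁ - ξ₂)) (onPair 0 2 (Rk τ μ κ (ξ₁ - ξ₃))
        (onPair 1 2 (Rk τ μ κ (ξ₂ - ξ₃)) f)) z
      = onPair 1 2 (Rk τ μ κ (ξ₂ - ξ₃)) (onPair 0 2 (Rk τ μ κ (ξ₁ - ξ₃))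
        (onPair 0 1 (Rk τ μ κ (ξ₁ - ξ₂)) f)) z := by
  have hz : z = ![z 0, z 1, z 2] := by ext l; fin_cases l <;> rfl
  have e : ξ₁ - ξ₃ = ξ₁ - ξ₂ + (ξ₂ - ξ₃) := by ring
  rw [e] at h13 h2 ⊢
  rw [hz]
  exact yang_baxter_of_notMem hτ hμ h12 h23 h13 f _ _ _ h1 h3 h2

/-- The quantum Yang-Baxter equation on theta functions. -/
lemma yang_baxter_of_mem_tensorV {τ μ ξ₁ ξ₂ ξ₃ : ℂ} (hτ : 0 < τ.im) {k : ℕ} (hk : 0 < k)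
    (hμ : μ ∉ lattice τ) (h12 : ξ₁ - ξ₂ ∉ lattice τ) (h13 : ξ₁ - ξ₃ ∉ lattice τ)
    (h23 : ξ₂ - ξ₃ ∉ lattice τ) {f : Fun 3} (hf : f ∈ tensorV τ k (fun _ : Fin 3 => 0)) :
    onPair 0 1 (Rk τ μ k (ξ₁ - ξ₂)) (onPair 0 2 (Rk τ μ k (ξ₁ - ξ₃))
        (onPair 1 2 (Rk τ μ k (ξ₂ - ξ₃)) f))
      = onPair 1 2 (Rk τ μ k (ξ₂ - ξ₃)) (onPair 0 2 (Rk τ μ k (ξ₁ - ξ₃))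
        (onPair 0 1 (Rk τ μ k (ξ₁ - ξ₂)) f)) := by
  have m : ∀ {i j : Fin 3} {ξ : ℂ} {f : Fun 3}, i ≠ j → ξ ∉ lattice τ →
      f ∈ tensorV τ k (fun _ : Fin 3 => 0) →
      onPair i j (Rk τ μ k ξ) f ∈ tensorV τ k (fun _ : Fin 3 => 0) :=
    fun hij hξ hf => onPair_Rk_mem_tensorV hτ hk hij hμ hξ hf
  -- Both sides lie in the tensor cube and are therefore continuous, so the pointwise equation off
  -- the poles determines them.
  exact eq_of_eq_notMem_lattice hτ
    (m (by decide) h12 (m (by decide) h13 (m (by decide) h23 hf))).1.continuous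
    (m (by decide) h23 (m (by decide) h13 (m (by decide) h12 hf))).1.continuous
    _ _ _ (yang_baxter_apply hτ hμ h12 h13 h23 f)

end EllipticR

end

theorem mainTheorem1 (τ μ : ℂ) (hτ : 0 < τ.im) (hμ : μ ∉ EllipticR.lattice τ)
    (k : ℕ) (hk : 0 < k) :
    -- the conjugated operator depends only on the difference of the spectral parameters
    (∀ ξ₁ ξ₂ : ℂ, EllipticR.conjR τ μ k ξ₁ ξ₂ = EllipticR.Rk τ μ k (ξ₁ - ξ₂)) ∧
    -- it maps the tensor square of `V_k = V_k(0)` (linearly) into itself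
    (∀ ξ : ℂ, ξ ∉ EllipticR.lattice τ →
      (∀ f ∈ EllipticR.tensorV τ k (fun _ : Fin 2 => 0),
        EllipticR.Rk τ μ k ξ f ∈ EllipticR.tensorV τ k (fun _ : Fin 2 => 0)) ∧
      (∀ f ∈ EllipticR.tensorV τ k (fun _ : Fin 2 => 0),
        ∀ g ∈ EllipticR.tensorV τ k (fun _ : Fin 2 => 0), ∀ a b : ℂ,
        EllipticR.Rk τ μ k ξ (a • f + b • g)
          = a • EllipticR.Rk τ μ k ξ f + b • EllipticR.Rk τ μ k ξ g)) ∧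
    -- quantum Yang-Baxter equation
    (∀ ξ₁ ξ₂ ξ₃ : ℂ, ξ₁ - ξ₂ ∉ EllipticR.lattice τ → ξ₁ - ξ₃ ∉ EllipticR.lattice τ →
      ξ₂ - ξ₃ ∉ EllipticR.lattice τ →
      -- on the tensor cube of `V_k`
      (∀ f ∈ EllipticR.tensorV τ k (fun _ : Fin 3 => 0),
        EllipticR.onPair 0 1 (EllipticR.Rk τ μ k (ξ₁ - ξ₂))
          (EllipticR.onPair 0 2 (EllipticR.Rk τ μ k (ξ₁ - ξ₃))
            (EllipticR.onPair 1 2 (EllipticR.Rk τ μ k (ξ₂ - ξ₃)) f))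
        = EllipticR.onPair 1 2 (EllipticR.Rk τ μ k (ξ₂ - ξ₃))
            (EllipticR.onPair 0 2 (EllipticR.Rk τ μ k (ξ₁ - ξ₃))
              (EllipticR.onPair 0 1 (EllipticR.Rk τ μ k (ξ₁ - ξ₂)) f))) ∧
      -- on arbitrary functions of three variables, away from the poles of the coefficients
      (∀ (f : EllipticR.Fun 3) (z : Fin 3 → ℂ),
        z 0 - z 1 + (ξ₁ - ξ₂ + μ) / k ∉ EllipticR.lattice τ →
        z 0 - z 2 + (ξ₁ - ξ₃ + 2 * μ) / k ∉ EllipticR.lattice τ →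
        z 1 - z 2 + (ξ₂ - ξ₃ + μ) / k ∉ EllipticR.lattice τ →
        EllipticR.onPair 0 1 (EllipticR.Rk τ μ k (ξ₁ - ξ₂))
          (EllipticR.onPair 0 2 (EllipticR.Rk τ μ k (ξ₁ - ξ₃))
            (EllipticR.onPair 1 2 (EllipticR.Rk τ μ k (ξ₂ - ξ₃)) f)) z
        = EllipticR.onPair 1 2 (EllipticR.Rk τ μ k (ξ₂ - ξ₃))
            (EllipticR.onPair 0 2 (EllipticR.Rk τ μ k (ξ₁ - ξ₃))
              (EllipticR.onPair 0 1 (EllipticR.Rk τ μ k (ξ₁ - ξ₂)) f)) z)) := by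

  refine ⟨fun ξ₁ ξ₂ => EllipticR.conjR_eq_Rk τ μ k ξ₁ ξ₂, fun ξ hξ => ⟨fun f hf => ?_,
    fun f hf g hg a b => EllipticR.Rk_linear hτ hk hμ hξ hf hg a b⟩,
    fun ξ₁ ξ₂ ξ₃ h12 h13 h23 => ⟨fun f hf =>
      EllipticR.yang_baxter_of_mem_tensorV hτ hk hμ h12 h13 h23 hf,
    fun f z h1 h2 h3 => EllipticR.yang_baxter_apply hτ hμ h12 h13 h23 f z h1 h2 h3⟩⟩
  have := EllipticR.onPair_Rk_mem_tensorV hτ hk (i := (0 : Fin 2)) (j := 1) (by decide) hμ hξ hf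
  rwa [EllipticR.onPair_zero_one] at this
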